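/- Setting. Let $\mathcal X\subseteq\mathbb R^m$ and $\Omega\subseteq\mathbb R^d$ be convex (Borel) sets. For $\theta\in\Omega$ let $f(\cdot;\theta)$ be a probability density on $\mathcal X$ (Lebesgue measure), with $f$ jointly continuous on $\mathcal X\times\Omega$, and let $g$ be a continuous, strictly positive probability density on $\mathcal X$. For $p\in[0,1)$ put $k_p(x;\theta)=(1-p)f(x;\theta)+p\,g(x)$. Let $\pi_0$ be a prior probability measure on $\Omega$ and $\theta^*\in\Omega$ the true parameter. For a dataset $X=(x_1,\dots,x_n)\in\mathcal X^n$ the posterior under $k_p$ is $$\mathbb P_{\pi_n}(S\mid X)=\frac{\int_S\prod_{i}k_p(x_i;\theta)\,\pi_0(d\theta)}{\int_\Omega\prod_{i}k_p(x_i;\theta)\,\pi_0(d\theta)}.$$ Two datasets of size $n$ are neighbouring if they have all entries but one in common. Let $h^2(q,r)=\frac12\int_{\mathcal X}(\sqrt q-\sqrt r)^2dx$. The bracketing number $N_{[]}(u,\mathcal P)$ is the least number of brackets $[L,U]$, with $L,U\ge0$ integrable and $h(L,U)\le u$, such that each $q\in\mathcal P$ satisfies $L\le q\le U$ on $\mathcal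 X$ for one of them; $H_{[]}=\log N_{[]}\in[0,\infty]$. For $\alpha\in(0,1]$ let $$\rho_{0,\alpha}(\theta^*,\theta)=\frac1\alpha\int_{\mathcal X}\Big[\Big(\frac{f(x;\theta^*)}{f(x;\theta)}\Big)^{\alpha}-1\Big]f(x;\theta^*)\,dx\in[0,\infty],\qquad S_{0,\alpha}(t)=\{\theta\in\Omega:\rho_{0,\alpha}(\theta^*,\theta)\le t\}.$$ Let $\tilde\nabla_\theta f(x;\theta)$ be the supremum, over unit vectors $u$ pointing from $\theta$ into $\Omega$, of the one-sided directional derivatives $\lim_{\xi\downarrow0}\xi^{-1}\big(f(x;\theta+\xi u)-f(x;\theta)\big)$. Theorem. There are universal constants $c,c_1,c_2>0$ with the following property. Let $(\phi_n)_{n\ge1}$ be a decreasing sequence of positive reals, $\alpha\in(0,1]$, $c_3,c_4>0$, $t_n=c_1\phi_n^2/8$, and suppose: 1. $\phi_n\to0$, $n\phi_n^2\to\infty$, and there are $\Omega_1\subseteq\Omega_2\subseteq\cdots$ with union $\Omega$ such that for all $n\ge1$: $\int_{\phi_n^2/2^{10}}^{\phi_n}H_{[]}^{1/2}\big(u,\{f(\cdot;\theta):\theta\in\Omega_n\}\big)\,du\le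 c\sqrt n\,\phi_n^2$. 2. For all $n\ge1$: $\pi_0(S_{0,\alpha}(t_n))\ge c_3e^{-2nt_n}$ and $nt_n>\max\{\tfrac1\alpha,\tfrac{c_1}{8c_2}\}\log n$. 3. For all $n\ge1$: $\pi_0(\Omega\setminus\Omega_n)\le c_4e^{-2c_1n\phi_n^2}$. 4. At each $(x,\theta)\in\mathcal X\times\Omega$ the above directional derivatives of $f(x;\cdot)$ exist and are bounded, and for each fixed $\theta\in\Omega$, $\sup_{x\in\mathcal X}|\tilde\nabla_\theta f(x;\theta)/g(x)|<\infty$. 5. For every $\psi>0$, $\inf_{\theta\in\Omega,\ \|\theta-\theta^*\|_2>\psi}h(f(\cdot;\theta),f(\cdot;\theta^*))>0$. Let $p_0\in(0,1)$. Then there are a sequence $T_n\in(0,\infty)$ and constants $C_1,C_2,C_3\in(0,\infty)$ such that the following holds for every decreasing sequence $(p_n)_{n\ge1}$ in $(0,p_0]$ with $p_n\to0$. (i) There is a sequence $\psi_n\to0$ such that for all large $n$, $$\forall\theta\in\Omega:\quad h(k_{p_n}(\cdot;\theta),k_{p_n}(\cdot;\theta^*))\le\phi_n\ \Longrightarrow\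 \|\theta-\theta^*\|_2\le\psi_n.\qquad(*)$$ (ii) Let $n\ge1$, let $\psi_n$ be any real number satisfying $(*)$, and let $(X,Z)$ be a random pair of neighbouring datasets of size $n$ such that each of $X$, $Z$ has i.i.d. entries with density $k_{p_n}(\cdot;\theta^*)$. Put $$\delta_n=\tfrac4{c_3}e^{-\frac12c_1n\phi_n^2},\quad\tilde\varepsilon_n=\frac{2(1-p_n)T_n\psi_n}{p_n},\quad\epsilon_n=\tilde\varepsilon_n+\log\big(\delta_n+e^{\tilde\varepsilon_n}\big),\quad c_5=\min\{c_1\alpha/8,\,c_2\}.$$ Then, the posteriors being those under $k_{p_n}$, the (outer) probability that $$\forall S\in\mathcal B(\Omega):\quad\mathbb P_{\pi_n}(S\mid X)\le e^{\epsilon_n}\,\mathbb P_{\pi_n}(S\mid Z)+\delta_n$$ fails is at most $C_1e^{-nc_5\phi_n^2}$ if $nc_2\phi_n^2\ge\log2$, and at most $(C_2+C_3(\log\phi_n)^2)e^{-nc_5\phi_n^2}$ otherwise. The same bound, with the same constants, holds when $T_n$ is replaced in $\tilde\varepsilon_n$ by any real $\tau_n$ with $|\tilde\nabla_\theta f(x;\theta)/g(x)|\le\tau_n$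 for all $x\in\mathcal X$ and all $\theta\in\Omega$ with $\|\theta-\theta^*\|_2\le\psi_n$. (iii) Consequently, if $(*)$ holds for all large $n$, then along any such sequence of pairs $(X,Z)$ the privacy inequality of (ii), with $T_n$ or with such $\tau_n$, holds with probability tending to one. -/

import Mathlib

open MeasureTheory Filter Topology Set
open scoped ENNReal

noncomputable section

/-- The statistical model: convex observation and parameter spaces in Euclidean space, a jointly
continuous likelihood `f x θ`, a positive continuous contamination density `g`, a prior
probability on the parameter space and a true parameter. All densities are with respect to
Lebesgue measure on the observation space; values of `f`, `g` off `obs`, `par` play no role. -/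
structure ContaminationModel (m d : ℕ) where
  /-- observation space -/
  obs : Set (EuclideanSpace ℝ (Fin m))
  /-- parameter space -/
  par : Set (EuclideanSpace ℝ (Fin d))
  /-- uncontaminated likelihood -/
  f : EuclideanSpace ℝ (Fin m) → EuclideanSpace ℝ (Fin d) → ℝ
  /-- contamination density -/
  g : EuclideanSpace ℝ (Fin m) → ℝ
  /-- prior distribution -/
  prior : Measure (EuclideanSpace ℝ (Fin d))
  /-- true parameter -/
  θstar : EuclideanSpace ℝ (Fin d)
  convex_obs : Convex ℝ obs
  measurableSet_obs : MeasurableSet obs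
  convex_par : Convex ℝ par
  measurableSet_par : MeasurableSet par
  θstar_mem : θstar ∈ par
  continuousOn_f : ContinuousOn (fun z : EuclideanSpace ℝ (Fin m) × EuclideanSpace ℝ (Fin d) =>
    f z.1 z.2) (obs ×ˢ par)
  f_nonneg : ∀ x ∈ obs, ∀ θ ∈ par, 0 ≤ f x θ
  integral_f : ∀ θ ∈ par, ∫ x in obs, f x θ = 1
  continuousOn_g : ContinuousOn g obs
  g_pos : ∀ x ∈ obs, 0 < g x
  integral_g : ∫ x in obs, g x = 1
  isProbabilityMeasure_prior : IsProbabilityMeasure prior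
  prior_compl : prior parᶜ = 0

/-- Hellinger distance of two nonnegative functions on `X`:
`h² = (1/2) ∫ (√q - √r)²`. -/
def hellinger {m : ℕ} (X : Set (EuclideanSpace ℝ (Fin m)))
    (q r : EuclideanSpace ℝ (Fin m) → ℝ) : ℝ :=
  Real.sqrt ((1 / 2) * ∫ x in X, (Real.sqrt (q x) - Real.sqrt (r x)) ^ 2)

/-- The family `𝒬` of functions on `X` has an `r`-Hellinger bracketing with `N` brackets
`[L j, U j]` made of nonnegative integrable functions. -/
def HasBracketing {m : ℕ} (X : Set (EuclideanSpace ℝ (Fin m))) (r : ℝ)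
    (𝒬 : Set (EuclideanSpace ℝ (Fin m) → ℝ)) (N : ℕ) : Prop :=
  ∃ L U : Fin N → EuclideanSpace ℝ (Fin m) → ℝ,
    (∀ j, IntegrableOn (L j) X ∧ IntegrableOn (U j) X ∧
      (∀ x ∈ X, 0 ≤ L j x) ∧ (∀ x ∈ X, 0 ≤ U j x) ∧ hellinger X (L j) (U j) ≤ r) ∧
    ∀ q ∈ 𝒬, ∃ j, ∀ x ∈ X, L j x ≤ q x ∧ q x ≤ U j x

/-- Hellinger bracketing number (`⊤` if there is no finite bracketing). -/
def bracketingNumber {m : ℕ} (X : Set (EuclideanSpace ℝ (Fin m))) (r : ℝ)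
    (𝒬 : Set (EuclideanSpace ℝ (Fin m) → ℝ)) : ℕ∞ :=
  ⨅ (N : ℕ) (_ : HasBracketing X r 𝒬 N), (N : ℕ∞)

/-- Square root of the Hellinger bracketing entropy, `(log N)^{1/2}`, with value `⊤` if the
bracketing number is infinite. -/
def sqrtBracketingEntropy {m : ℕ} (X : Set (EuclideanSpace ℝ (Fin m))) (r : ℝ)
    (𝒬 : Set (EuclideanSpace ℝ (Fin m) → ℝ)) : ℝ≥0∞ :=
  if bracketingNumber X r 𝒬 = ⊤ then ⊤
  else ENNReal.ofReal (Real.sqrt (Real.log (bracketingNumber X r 𝒬).toNat))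

/-- `x` and `z` are neighbouring datasets: they have all entries but one in common. -/
def Neighbouring {E : Type*} {n : ℕ} (x z : Fin n → E) : Prop :=
  ∃ i, ∀ j, j ≠ i → x j = z j

/-- Unit vectors along which one can leave `θ` without immediately leaving the (convex) set
`A`; these are all unit vectors if `θ` is an interior point. -/
def feasibleDirections {d : ℕ} (A : Set (EuclideanSpace ℝ (Fin d)))
    (θ : EuclideanSpace ℝ (Fin d)) : Set (EuclideanSpace ℝ (Fin d)) :=
  {u | ‖u‖ = 1 ∧ ∃ ξ : ℝ, 0 < ξ ∧ θ + ξ • u ∈ A}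

/-- One-sided directional derivative `lim_{ξ ↓ 0} (φ (θ + ξ u) - φ θ) / ξ`. -/
def dirDeriv {d : ℕ} (φ : EuclideanSpace ℝ (Fin d) → ℝ) (θ u : EuclideanSpace ℝ (Fin d)) : ℝ :=
  derivWithin (fun ξ : ℝ => φ (θ + ξ • u)) (Ici 0) 0

namespace ContaminationModel

variable {m d : ℕ} (M : ContaminationModel m d)

/-- Contaminated likelihood `k_p = (1 - p) f + p g`. -/
def k (p : ℝ) (x : EuclideanSpace ℝ (Fin m)) (θ : EuclideanSpace ℝ (Fin d)) : ℝ :=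
  (1 - p) * M.f x θ + p * M.g x

/-- Hellinger distance between `k_p(·;θ)` and `k_p(·;θ')`; for `p = 0` that between
`f(·;θ)` and `f(·;θ')`. -/
def hell (p : ℝ) (θ θ' : EuclideanSpace ℝ (Fin d)) : ℝ :=
  hellinger M.obs (fun x => M.k p x θ) (fun x => M.k p x θ')

/-- `ρ_{p,α}(θ,ϑ) = (1/α) ∫ [(k_p(x;θ)/k_p(x;ϑ))^α - 1] k_p(x;θ) dx`, possibly `+∞`. As
`k_p(·;θ)` has integral one, the `-1` is taken out of the integral. -/
def rho (p α : ℝ) (θ ϑ : EuclideanSpace ℝ (Fin d)) : EReal :=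
  ((1 / α : ℝ) : EReal) *
    (((∫⁻ x in M.obs, (ENNReal.ofReal (M.k p x θ) / ENNReal.ofReal (M.k p x ϑ)) ^ α *
      ENNReal.ofReal (M.k p x θ) : ℝ≥0∞) : EReal) - 1)

/-- The neighbourhood `S_{p,α}(t)` of the true parameter. -/
def rhoBall (p α t : ℝ) : Set (EuclideanSpace ℝ (Fin d)) :=
  {θ | θ ∈ M.par ∧ M.rho p α M.θstar θ ≤ (t : EReal)}

/-- Supremum of the directional derivatives of `f(x;·)` at `θ`. -/
def supDirDeriv (x : EuclideanSpace ℝ (Fin m)) (θ : EuclideanSpace ℝ (Fin d)) : ℝ :=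
  sSup (dirDeriv (M.f x) θ '' feasibleDirections M.par θ)

/-- Bracketing-entropy assumption for the rates `φ n` and sieves `Om n`, `n ≥ 1`, with
constant `c`. -/
def EntropyAssumption (c : ℝ) (φ : ℕ → ℝ) (Om : ℕ → Set (EuclideanSpace ℝ (Fin d))) : Prop :=
  (∀ n, 1 ≤ n → 0 < φ n) ∧ Tendsto φ atTop (𝓝 0) ∧
  Tendsto (fun n : ℕ => (n : ℝ) * φ n ^ 2) atTop atTop ∧
  (∀ n, 1 ≤ n → Om n ⊆ Om (n + 1)) ∧ (⋃ n ∈ Ici 1, Om n) = M.par ∧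
  ∀ n, 1 ≤ n →
    ∫⁻ u in Ioc (φ n ^ 2 / 2 ^ 10) (φ n),
        sqrtBracketingEntropy M.obs u ((fun θ x => M.f x θ) '' Om n)
      ≤ ENNReal.ofReal (c * Real.sqrt n * φ n ^ 2)

/-- Prior-concentration assumption, with `t n = c₁ (φ n)² / 8`. The growth condition is
multiplied out by `log n`, which vanishes for `n = 1`. -/
def PriorCentreAssumption (c₁ c₂ α c₃ : ℝ) (φ : ℕ → ℝ) : Prop :=
  ∀ n : ℕ, 1 ≤ n →
    ENNReal.ofReal (c₃ * Real.exp (-(2 * n * (c₁ * φ n ^ 2 / 8))))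
      ≤ M.prior (M.rhoBall 0 α (c₁ * φ n ^ 2 / 8)) ∧
    max (1 / α) (c₁ / (8 * c₂)) * Real.log n < n * (c₁ * φ n ^ 2 / 8)

/-- Prior-tail assumption. -/
def PriorTailAssumption (c₁ c₄ : ℝ) (φ : ℕ → ℝ)
    (Om : ℕ → Set (EuclideanSpace ℝ (Fin d))) : Prop :=
  ∀ n : ℕ, 1 ≤ n →
    M.prior (M.par \ Om n) ≤ ENNReal.ofReal (c₄ * Real.exp (-(2 * c₁ * n * φ n ^ 2)))

/-- The directional derivatives of `f(x;·)` exist and are bounded at each point, and for each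
fixed `θ` their supremum is at most a constant times `g`. -/
def TailAssumption : Prop :=
  (∀ x ∈ M.obs, ∀ θ ∈ M.par,
    (∀ u ∈ feasibleDirections M.par θ,
      DifferentiableWithinAt ℝ (fun ξ : ℝ => M.f x (θ + ξ • u)) (Ici 0) 0) ∧
    ∃ B : ℝ, ∀ u ∈ feasibleDirections M.par θ, |dirDeriv (M.f x) θ u| ≤ B) ∧
  ∀ θ ∈ M.par, ∃ B : ℝ, ∀ x ∈ M.obs, |M.supDirDeriv x θ / M.g x| ≤ B

/-- Hellinger identifiability of the uncontaminated model at the true parameter. -/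
def IdentifiabilityAssumption : Prop :=
  ∀ ψ : ℝ, 0 < ψ → ∃ η : ℝ, 0 < η ∧
    ∀ θ ∈ M.par, ψ < ‖θ - M.θstar‖ → η ≤ M.hell 0 θ M.θstar

/-- The Hellinger ball of radius `φ` around the true parameter (in the contaminated model) lies
in the Euclidean ball of radius `ψ`. -/
def RadiusBound (p φ ψ : ℝ) : Prop :=
  ∀ θ ∈ M.par, M.hell p θ M.θstar ≤ φ → ‖θ - M.θstar‖ ≤ ψ

/-- `τ` bounds `|∇̃f / g|` over all observations and all parameters within `ψ` of the true one. -/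
def DerivRatioBound (ψ τ : ℝ) : Prop :=
  ∀ θ ∈ M.par, ‖θ - M.θstar‖ ≤ ψ → ∀ x ∈ M.obs, |M.supDirDeriv x θ / M.g x| ≤ τ

/-- Law of one observation: density `k_p(·;θ*)` on the observation space. -/
def dataLaw (p : ℝ) : Measure (EuclideanSpace ℝ (Fin m)) :=
  (volume.restrict M.obs).withDensity (fun x => ENNReal.ofReal (M.k p x M.θstar))

/-- Joint law of a random pair of neighbouring datasets of size `n`, each of which has
i.i.d. entries with density `k_p(·;θ*)`. -/
def IsNeighbourLaw (p : ℝ) (n : ℕ)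
    (P : Measure ((Fin n → EuclideanSpace ℝ (Fin m)) × (Fin n → EuclideanSpace ℝ (Fin m)))) :
    Prop :=
  P.map Prod.fst = Measure.pi (fun _ => M.dataLaw p) ∧
  P.map Prod.snd = Measure.pi (fun _ => M.dataLaw p) ∧
  ∀ᵐ w ∂P, Neighbouring w.1 w.2

/-- Posterior probability of `S` given the dataset `x`, under the likelihood `k_p`. -/
def posterior (p : ℝ) {n : ℕ} (x : Fin n → EuclideanSpace ℝ (Fin m))
    (S : Set (EuclideanSpace ℝ (Fin d))) : ℝ≥0∞ :=
  (∫⁻ θ in S, ∏ i, ENNReal.ofReal (M.k p (x i) θ) ∂M.prior) /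
    (∫⁻ θ in M.par, ∏ i, ENNReal.ofReal (M.k p (x i) θ) ∂M.prior)

/-- The event that the `(ε, δ)` privacy inequality fails for some measurable `S`. -/
def privacyFailure (p : ℝ) (n : ℕ) (ε δ : ℝ) :
    Set ((Fin n → EuclideanSpace ℝ (Fin m)) × (Fin n → EuclideanSpace ℝ (Fin m))) :=
  {w | ¬ ∀ S : Set (EuclideanSpace ℝ (Fin d)), MeasurableSet S → S ⊆ M.par →
    M.posterior p w.1 S
      ≤ ENNReal.ofReal (Real.exp ε) * M.posterior p w.2 S + ENNReal.ofReal δ}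

end ContaminationModel

/-- `δ_n = (4/c₃) exp(-c₁ n φ² / 2)`. -/
def deltaLevel (c₁ c₃ : ℝ) (n : ℕ) (φ : ℝ) : ℝ :=
  4 / c₃ * Real.exp (-(1 / 2 * c₁ * n * φ ^ 2))

/-- `ε̃_n = 2 (1 - p) T ψ / p`. -/
def epsTilde (p T ψ : ℝ) : ℝ := 2 * (1 - p) * T * ψ / p

/-- `ε_n = ε̃_n + log (δ_n + exp ε̃_n)`. -/
def epsLevel (δ p T ψ : ℝ) : ℝ :=
  epsTilde p T ψ + Real.log (δ + Real.exp (epsTilde p T ψ))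

/-- The bound on the failure probability, with `c₅ = min (c₁ α / 8) c₂`. -/
def failureBound (c₁ c₂ α C₁ C₂ C₃ : ℝ) (n : ℕ) (φ : ℝ) : ℝ :=
  if Real.log 2 ≤ n * c₂ * φ ^ 2 then
    C₁ * Real.exp (-(n * min (c₁ * α / 8) c₂ * φ ^ 2))
  else
    (C₂ + C₃ * Real.log φ ^ 2) * Real.exp (-(n * min (c₁ * α / 8) c₂ * φ ^ 2))

end

/-! The posterior given `X` concentrates on a Hellinger ball around `θstar`: prior concentration in
`ρ₀,α` bounds the evidence from below, bracketing entropy bounds the likelihood ratio on the sieve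
uniformly outside the ball, and the prior tail takes care of the complement of the sieve. Since
contamination contracts Hellinger distances, this holds uniformly in the mixing weight.

Inside the ball, replacing one entry of the dataset changes the likelihood by a ratio
`k(x; θ) / k(x; θstar)`. Because `k ≥ p g`, a bound `τ` on `|∇̃f / g|` turns the radius `ψ` into a
bound `exp (ε̃ / 2)` on this ratio and on its inverse. Posteriors of neighbouring datasets then
agree up to `exp ε̃` on the ball and up to the small mass outside it.

The constant `T` must not depend on `p` or on the radius `ψ`. Unless `Ω` is a point, every
admissible `ψ` is at least the distance to a fixed second parameter, so a large `T` makes `T * ψ`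
exceed a threshold that `f / g` passes only with small probability. -/

section IntegratedLikelihoodRatio

lemma lintegral_pi_prod_eval {ι : Type*} [Fintype ι] {E : ι → Type*} [∀ i, MeasurableSpace (E i)]
    (P : ∀ i, Measure (E i)) [∀ i, IsProbabilityMeasure (P i)] (F : ∀ i, E i → ℝ≥0∞)
    (hF : ∀ i, Measurable (F i)) :
    ∫⁻ x, ∏ i, F i (x i) ∂(Measure.pi P) = ∏ i, ∫⁻ y, F i y ∂(P i) := by
  have h := ProbabilityTheory.lintegral_prod_eq_prod_lintegral_of_indepFun
    (μ := Measure.pi P) Finset.univ (fun i x => F i (x i))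
    (ProbabilityTheory.iIndepFun_pi fun i => (hF i).aemeasurable)
    fun i => (hF i).comp (measurable_pi_apply i)
  rw [h]
  exact Finset.prod_congr rfl fun i _ => (measurePreserving_eval P i).lintegral_comp (hF i)

lemma lintegral_eval_mul_prod_eval_le {ι E : Type*} [Fintype ι] [MeasurableSpace E]
    (P : Measure E) [IsProbabilityMeasure P] {G F : E → ℝ≥0∞} (hG : Measurable G)
    (hF : Measurable F) (hF1 : ∫⁻ y, F y ∂P ≤ 1) (i : ι) :
    ∫⁻ x, G (x i) * ∏ j, F (x j) ∂(Measure.pi fun _ : ι => P) ≤ ∫⁻ y, G y * F y ∂P := by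
  classical
  let H : ι → E → ℝ≥0∞ := fun j y => (if j = i then G y else 1) * F y
  have hH : ∀ j, Measurable (H j) := fun j => by
    by_cases hj : j = i
    · simpa only [H, hj, if_true] using! hG.mul hF
    · simpa only [H, hj, if_false, one_mul] using! hF
  calc ∫⁻ x, G (x i) * ∏ j, F (x j) ∂(Measure.pi fun _ : ι => P)
      = ∫⁻ x, ∏ j, H j (x j) ∂(Measure.pi fun _ : ι => P) := by
        simp only [H, Finset.prod_mul_distrib, Finset.prod_ite_eq', Finset.mem_univ, if_true]
    _ = (∫⁻ y, H i y ∂P) * ∏ j ∈ Finset.univ.erase i, ∫⁻ y, H j y ∂P := by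
        rw [lintegral_pi_prod_eval _ _ hH,
          Finset.mul_prod_erase _ (fun j => ∫⁻ y, H j y ∂P) (Finset.mem_univ i)]
    _ ≤ (∫⁻ y, H i y ∂P) * 1 := by
        gcongr
        refine Finset.prod_le_one' fun j hj => ?_
        simpa only [H, Finset.ne_of_mem_erase hj, if_false, one_mul] using hF1
    _ = ∫⁻ y, G y * F y ∂P := by simp only [H, if_true, mul_one]

/-- Likelihood ratio of the dataset `x` with independent entries, given the likelihood ratio `r`
of a single observation. -/
noncomputable def likRatio {E Θ : Type*} {n : ℕ} (r : E → Θ → ℝ≥0∞) (x : Fin n → E) (θ : Θ) :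
    ℝ≥0∞ :=
  ∏ j, r (x j) θ

variable {E Θ : Type*} [MeasurableSpace E] [MeasurableSpace Θ] {n : ℕ} {r : E → Θ → ℝ≥0∞}

lemma measurable_likRatio (hr : Measurable (Function.uncurry r)) :
    Measurable (Function.uncurry (likRatio (n := n) r)) := by
  have h := Finset.measurable_prod Finset.univ fun (j : Fin n) _ =>
    hr.comp (((measurable_pi_apply j).comp measurable_fst).prodMk
      (measurable_snd : Measurable (Prod.snd : (Fin n → E) × Θ → Θ)))
  exact h

lemma measure_le_setLIntegral_le_lintegral_lintegral_div {Ω : Type*} [MeasurableSpace Ω]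
    (Q : Measure Ω) [SFinite Q] (π : Measure Θ) [SFinite π] (A : Set Θ) {Φ : Ω → Θ → ℝ≥0∞}
    (hΦ : Measurable (Function.uncurry Φ)) {κ : ℝ≥0∞} (hκ : κ ≠ 0) (hκ' : κ ≠ ∞) :
    Q {x | κ ≤ ∫⁻ θ in A, Φ x θ ∂π} ≤ (∫⁻ θ in A, ∫⁻ x, Φ x θ ∂Q ∂π) / κ := by
  rw [← lintegral_lintegral_swap hΦ.aemeasurable]
  exact meas_ge_le_lintegral_div
    (hΦ.lintegral_prod_right' (ν := π.restrict A)).aemeasurable hκ hκ'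

lemma measure_le_setLIntegral_le_mul_div {Ω : Type*} [MeasurableSpace Ω] (Q : Measure Ω)
    [SFinite Q] (π : Measure Θ) [SFinite π] {A : Set Θ} (hA : MeasurableSet A)
    {Φ : Ω → Θ → ℝ≥0∞} (hΦ : Measurable (Function.uncurry Φ)) {B κ : ℝ≥0∞} (hκ : κ ≠ 0)
    (hκ' : κ ≠ ∞) (hB : ∀ θ ∈ A, ∫⁻ x, Φ x θ ∂Q ≤ B) :
    Q {x | κ ≤ ∫⁻ θ in A, Φ x θ ∂π} ≤ B * π A / κ := by
  refine (measure_le_setLIntegral_le_lintegral_lintegral_div Q π A hΦ hκ hκ').trans ?_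
  gcongr
  exact (setLIntegral_mono' hA hB).trans_eq (setLIntegral_const A B)

lemma half_measure_univ_mul_inv_le_lintegral (ν : Measure Θ) [IsFiniteMeasure ν] {G : Θ → ℝ≥0∞}
    (hG : Measurable G) {α : ℝ} (hα : 0 < α) {c : ℝ≥0∞} (hc : c ≠ 0) (hc' : c ≠ ∞)
    (h : ∫⁻ θ, (G θ)⁻¹ ^ α ∂ν ≤ 2⁻¹ * ν univ * c ^ α) :
    2⁻¹ * ν univ * c⁻¹ ≤ ∫⁻ θ, G θ ∂ν := by
  have hsmall : ν {θ | c⁻¹ ≤ G θ}ᶜ ≤ 2⁻¹ * ν univ :=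
    calc ν {θ | c⁻¹ ≤ G θ}ᶜ ≤ ν {θ | c ^ α ≤ (G θ)⁻¹ ^ α} := by
          refine measure_mono fun θ (hθ : ¬c⁻¹ ≤ G θ) => ?_
          exact ENNReal.rpow_le_rpow (ENNReal.le_inv_iff_le_inv.2 (not_le.1 hθ).le) hα.le
      _ ≤ (∫⁻ θ, (G θ)⁻¹ ^ α ∂ν) / c ^ α :=
          meas_ge_le_lintegral_div (hG.inv.pow_const α).aemeasurable (by simp [hc, hc'])
            (by simp [hc, hc'])
      _ ≤ 2⁻¹ * ν univ := ENNReal.div_le_of_le_mul h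
  have hlarge : 2⁻¹ * ν univ ≤ ν {θ | c⁻¹ ≤ G θ} := by
    refine (ENNReal.add_le_add_iff_right (a := 2⁻¹ * ν univ)
      (ENNReal.mul_ne_top (by simp) (measure_ne_top ν _))).1 ?_
    calc 2⁻¹ * ν univ + 2⁻¹ * ν univ = ν univ := by
          rw [← add_mul, ENNReal.inv_two_add_inv_two, one_mul]
      _ ≤ ν {θ | c⁻¹ ≤ G θ} + ν {θ | c⁻¹ ≤ G θ}ᶜ := measure_univ_le_add_compl _
      _ ≤ ν {θ | c⁻¹ ≤ G θ} + 2⁻¹ * ν univ := by gcongr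
  calc 2⁻¹ * ν univ * c⁻¹ ≤ c⁻¹ * ν {θ | c⁻¹ ≤ G θ} := by rw [mul_comm]; gcongr
    _ ≤ ∫⁻ θ, G θ ∂ν := mul_meas_ge_le_lintegral hG _

variable (P : Measure E) [IsProbabilityMeasure P]

lemma lintegral_likRatio_le_one (hr : Measurable (Function.uncurry r)) {θ : Θ}
    (h : ∫⁻ y, r y θ ∂P ≤ 1) :
    ∫⁻ x, likRatio (n := n) r x θ ∂(Measure.pi fun _ : Fin n => P) ≤ 1 := by
  simp only [likRatio]
  rw [lintegral_pi_prod_eval _ (fun _ y => r y θ) fun _ => hr.of_uncurry_right]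
  exact Finset.prod_le_one' fun _ _ => h

lemma measure_exists_one_le_prod_le {ι : Type*} (F : Finset ι) {w : ι → E → ℝ≥0∞}
    (hw : ∀ i, Measurable (w i)) {e : ℝ≥0∞} (h : ∀ i ∈ F, ∫⁻ y, w i y ∂P ≤ e) :
    (Measure.pi fun _ : Fin n => P) {x | ∃ i ∈ F, 1 ≤ ∏ j, w i (x j)} ≤ F.card * e ^ n := by
  have hprod : ∀ i ∈ F, (Measure.pi fun _ : Fin n => P) {x | 1 ≤ ∏ j, w i (x j)} ≤ e ^ n :=
    fun i hi => by
      have hmeas : Measurable fun x : Fin n → E => ∏ j, w i (x j) :=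
        Finset.measurable_prod _ fun j _ => (hw i).comp (measurable_pi_apply j)
      refine (meas_ge_le_lintegral_div hmeas.aemeasurable one_ne_zero
        ENNReal.one_ne_top).trans ?_
      rw [div_one, lintegral_pi_prod_eval _ (fun _ => w i) fun _ => hw i]
      simpa using pow_le_pow_left' (h i hi) n
  have hunion : {x : Fin n → E | ∃ i ∈ F, 1 ≤ ∏ j, w i (x j)}
      = ⋃ i ∈ F, {x | 1 ≤ ∏ j, w i (x j)} := by ext; simp
  rw [hunion, ← nsmul_eq_mul]
  exact (measure_biUnion_finset_le _ _).trans (Finset.sum_le_card_nsmul _ _ _ hprod)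

lemma setLIntegral_prod_le_one_likRatio_le (hr : Measurable (Function.uncurry r)) (θ : Θ)
    {w : E → ℝ≥0∞} (hw : Measurable w) (hw0 : ∀ y, w y ≠ 0) :
    ∫⁻ x in {x : Fin n → E | ∏ j, w (x j) ≤ 1}, likRatio r x θ ∂(Measure.pi fun _ : Fin n => P)
      ≤ (∫⁻ y, r y θ * (w y)⁻¹ ∂P) ^ n := by
  have hset : MeasurableSet {x : Fin n → E | ∏ j, w (x j) ≤ 1} :=
    measurableSet_le (Finset.measurable_prod _ fun j _ => hw.comp (measurable_pi_apply j))
      measurable_const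
  calc ∫⁻ x in {x : Fin n → E | ∏ j, w (x j) ≤ 1}, likRatio r x θ ∂(Measure.pi fun _ : Fin n => P)
      ≤ ∫⁻ x in {x : Fin n → E | ∏ j, w (x j) ≤ 1}, ∏ j, (r (x j) θ * (w (x j))⁻¹)
          ∂(Measure.pi fun _ : Fin n => P) := by
        refine setLIntegral_mono' hset fun x hx => ?_
        rw [Finset.prod_mul_distrib, ← ENNReal.prod_inv_distrib fun _ _ _ _ _ => Or.inl (hw0 _)]
        exact le_mul_of_one_le_right' (ENNReal.one_le_inv.2 hx)
    _ ≤ ∫⁻ x, ∏ j, (r (x j) θ * (w (x j))⁻¹) ∂(Measure.pi fun _ : Fin n => P) :=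
        setLIntegral_le_lintegral _ _
    _ = (∫⁻ y, r y θ * (w y)⁻¹ ∂P) ^ n := by
        rw [lintegral_pi_prod_eval _ (fun _ y => r y θ * (w y)⁻¹) fun _ =>
          hr.of_uncurry_right.mul hw.inv]
        simp

variable (π : Measure Θ)

lemma measure_le_setLIntegral_likRatio_le [SFinite π] (hr : Measurable (Function.uncurry r))
    {A : Set Θ} (hA : MeasurableSet A) (h : ∀ θ ∈ A, ∫⁻ y, r y θ ∂P ≤ 1)
    {κ : ℝ≥0∞} (hκ : κ ≠ 0) (hκ' : κ ≠ ∞) :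
    (Measure.pi fun _ : Fin n => P) {x | κ ≤ ∫⁻ θ in A, likRatio r x θ ∂π} ≤ π A / κ := by
  simpa using measure_le_setLIntegral_le_mul_div (Measure.pi fun _ : Fin n => P) π hA
    (measurable_likRatio hr) hκ hκ' fun θ hθ => lintegral_likRatio_le_one P hr (h θ hθ)

/-- The test statistics are the products `∏ j, w i (x j)`: the test `i` rejects when its statistic
is at least one, and on acceptance the likelihood ratio is dominated by that divided by the
statistic. -/
lemma measure_le_setLIntegral_likRatio_le_of_tests [SFinite π]
    (hr : Measurable (Function.uncurry r)) {A : Set Θ} (hA : MeasurableSet A) {ι : Type*}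
    (F : Finset ι) {w : ι → E → ℝ≥0∞} (hw : ∀ i, Measurable (w i)) (hw0 : ∀ i y, w i y ≠ 0)
    {e : ℝ≥0∞} (h₁ : ∀ i ∈ F, ∫⁻ y, w i y ∂P ≤ e)
    (h₂ : ∀ θ ∈ A, ∃ i ∈ F, ∫⁻ y, r y θ * (w i y)⁻¹ ∂P ≤ e)
    {κ : ℝ≥0∞} (hκ : κ ≠ 0) (hκ' : κ ≠ ∞) :
    (Measure.pi fun _ : Fin n => P) {x | κ ≤ ∫⁻ θ in A, likRatio r x θ ∂π}
      ≤ F.card * e ^ n + e ^ n * π A / κ := by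
  let R : Set (Fin n → E) := {x | ∃ i ∈ F, 1 ≤ ∏ j, w i (x j)}
  have hR : MeasurableSet R := by
    have hRU : R = ⋃ i ∈ F, {x | 1 ≤ ∏ j, w i (x j)} := by ext; simp [R]
    rw [hRU]
    exact F.measurableSet_biUnion fun i _ => measurableSet_le measurable_const
      (Finset.measurable_prod _ fun j _ => (hw i).comp (measurable_pi_apply j))
  refine (measure_le_inter_add_sdiff _ _ R).trans (add_le_add ?_ ?_)
  · exact (measure_mono inter_subset_right).trans (measure_exists_one_le_prod_le P F hw h₁)
  · rw [sdiff_eq, ← Measure.restrict_apply' hR.compl]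
    refine measure_le_setLIntegral_le_mul_div _ π hA (measurable_likRatio hr) hκ hκ'
      fun θ hθ => ?_
    obtain ⟨i, hi, hie⟩ := h₂ θ hθ
    have haccept : Rᶜ ⊆ {x | ∏ j, w i (x j) ≤ 1} := fun x hx =>
      le_of_lt (not_le.1 fun hle => hx ⟨i, hi, hle⟩)
    calc ∫⁻ x in Rᶜ, likRatio r x θ ∂(Measure.pi fun _ : Fin n => P)
        ≤ ∫⁻ x in {x | ∏ j, w i (x j) ≤ 1}, likRatio r x θ ∂(Measure.pi fun _ : Fin n => P) :=
          lintegral_mono_set haccept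
      _ ≤ (∫⁻ y, r y θ * (w i y)⁻¹ ∂P) ^ n :=
          setLIntegral_prod_le_one_likRatio_le P hr θ (hw i) (hw0 i)
      _ ≤ e ^ n := pow_le_pow_left' hie n

lemma lintegral_inv_likRatio_rpow (hr : Measurable (Function.uncurry r)) {θ : Θ}
    (hr0 : ∀ y, r y θ ≠ 0) {α : ℝ} (hα : 0 ≤ α) :
    ∫⁻ x, (likRatio (n := n) r x θ)⁻¹ ^ α ∂(Measure.pi fun _ : Fin n => P)
      = (∫⁻ y, (r y θ)⁻¹ ^ α ∂P) ^ n := by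
  simp only [likRatio, ENNReal.prod_inv_distrib fun _ _ _ _ _ => Or.inl (hr0 _),
    ← ENNReal.prod_rpow_of_nonneg hα]
  rw [lintegral_pi_prod_eval _ (fun _ y => (r y θ)⁻¹ ^ α) fun _ =>
    hr.of_uncurry_right.inv.pow_const α]
  simp only [Finset.prod_const, Finset.card_univ, Fintype.card_fin]

lemma measure_setLIntegral_likRatio_lt_le [IsFiniteMeasure π]
    (hr : Measurable (Function.uncurry r)) (hr0 : ∀ x θ, r x θ ≠ 0) {S : Set Θ}
    (hS : MeasurableSet S) {α t : ℝ} (hα : 0 < α)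
    (h : ∀ θ ∈ S, ∫⁻ y, (r y θ)⁻¹ ^ α ∂P ≤ ENNReal.ofReal (Real.exp (α * t))) :
    (Measure.pi fun _ : Fin n => P) {x | ∫⁻ θ in S, likRatio r x θ ∂π
      < 2⁻¹ * π S * ENNReal.ofReal (Real.exp (-(2 * n * t)))}
      ≤ 2 * ENNReal.ofReal (Real.exp (-(n * (α * t)))) := by
  rcases eq_or_ne (π S) 0 with hS0 | hS0
  · simp [hS0]
  let c : ℝ≥0∞ := ENNReal.ofReal (Real.exp (2 * n * t))
  have hc : c ≠ 0 := by simp [c, Real.exp_pos]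
  have hc' : c ≠ ∞ := ENNReal.ofReal_ne_top
  let κ : ℝ≥0∞ := 2⁻¹ * π S * c ^ α
  have hκ : κ ≠ 0 := by simp [κ, hS0, hc, hc']
  have hκ' : κ ≠ ∞ := ENNReal.mul_ne_top
    (ENNReal.mul_ne_top (by simp) (measure_ne_top π S)) (by simp [hc, hc'])
  have hmoment : ∀ θ ∈ S, ∫⁻ x, (likRatio (n := n) r x θ)⁻¹ ^ α ∂(Measure.pi fun _ : Fin n => P)
      ≤ ENNReal.ofReal (Real.exp (n * (α * t))) := fun θ hθ => by
    rw [lintegral_inv_likRatio_rpow P hr (hr0 · θ) hα.le, Real.exp_nat_mul,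
      ENNReal.ofReal_pow (Real.exp_pos _).le]
    exact pow_le_pow_left' (h θ hθ) n
  calc _ ≤ (Measure.pi fun _ : Fin n => P) {x | κ ≤ ∫⁻ θ in S, (likRatio r x θ)⁻¹ ^ α ∂π} := by
        refine measure_mono fun x hx => ?_
        by_contra hlt
        have hle : ∫⁻ θ in S, (likRatio r x θ)⁻¹ ^ α ∂π ≤ κ := (not_le.1 hlt).le
        refine absurd (mem_ofPred_eq ▸ hx) (not_lt.2 ?_)
        have h' := half_measure_univ_mul_inv_le_lintegral (π.restrict S)
          ((measurable_likRatio hr).of_uncurry_left (x := x)) hα hc hc'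
          (by simpa only [Measure.restrict_apply_univ] using hle)
        rwa [Measure.restrict_apply_univ, ← ENNReal.ofReal_inv_of_pos (Real.exp_pos _),
          ← Real.exp_neg] at h'
    _ ≤ ENNReal.ofReal (Real.exp (n * (α * t))) * π S / κ :=
        measure_le_setLIntegral_le_mul_div _ π hS ((measurable_likRatio hr).inv.pow_const α)
          hκ hκ' hmoment
    _ ≤ 2 * ENNReal.ofReal (Real.exp (-(n * (α * t)))) := by
        have hexp : ENNReal.ofReal (Real.exp (-(n * (α * t)))) * c ^ α
            = ENNReal.ofReal (Real.exp (n * (α * t))) := by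
          rw [ENNReal.ofReal_rpow_of_pos (Real.exp_pos _), ← Real.exp_mul,
            ← ENNReal.ofReal_mul (Real.exp_pos _).le, ← Real.exp_add]
          ring_nf
        rw [ENNReal.div_le_iff hκ hκ', ← hexp, ← one_mul (_ * π S),
          ← ENNReal.mul_inv_cancel two_ne_zero ENNReal.ofNat_ne_top]
        exact le_of_eq (by ring)

lemma setLIntegral_inter_exists_likRatio_le {A : Set Θ} (hA : MeasurableSet A) {D : Set (E × Θ)}
    (hD : MeasurableSet D) (x : Fin n → E) :
    ∫⁻ θ in A ∩ {θ | ∃ j, (x j, θ) ∈ D}, likRatio r x θ ∂π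
      ≤ ∫⁻ θ in A, ∑ i, D.indicator 1 (x i, θ) * likRatio r x θ ∂π := by
  have hDx : MeasurableSet {θ | ∃ j, (x j, θ) ∈ D} := by
    rw [ofPred_exists]
    exact MeasurableSet.iUnion fun j => hD.preimage measurable_prodMk_left
  refine (setLIntegral_mono' (hA.inter hDx) fun θ hθ => ?_).trans
    (lintegral_mono_set inter_subset_left)
  obtain ⟨i, hi⟩ := hθ.2
  calc likRatio r x θ = D.indicator 1 (x i, θ) * likRatio r x θ := by simp [hi]
    _ ≤ ∑ i, D.indicator 1 (x i, θ) * likRatio r x θ :=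
        Finset.single_le_sum (f := fun i => D.indicator 1 (x i, θ) * likRatio r x θ)
          (fun _ _ => zero_le) (Finset.mem_univ i)

lemma measure_le_setLIntegral_likRatio_le_of_exists [SFinite π]
    (hr : Measurable (Function.uncurry r)) {A : Set Θ} (hA : MeasurableSet A)
    (h : ∀ θ ∈ A, ∫⁻ y, r y θ ∂P ≤ 1) {D : Set (E × Θ)} (hD : MeasurableSet D)
    {κ : ℝ≥0∞} (hκ : κ ≠ 0) (hκ' : κ ≠ ∞) :
    (Measure.pi fun _ : Fin n => P)
        {x | κ ≤ ∫⁻ θ in A ∩ {θ | ∃ j, (x j, θ) ∈ D}, likRatio r x θ ∂π}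
      ≤ n * (∫⁻ θ in A, ∫⁻ y, D.indicator 1 (y, θ) * r y θ ∂P ∂π) / κ := by
  have hI : Measurable (D.indicator (1 : E × Θ → ℝ≥0∞)) := measurable_one.indicator hD
  let Φ : (Fin n → E) → Θ → ℝ≥0∞ := fun x θ =>
    ∑ i, D.indicator 1 (x i, θ) * likRatio r x θ
  have hterm : ∀ i : Fin n, Measurable fun z : (Fin n → E) × Θ =>
      D.indicator (1 : E × Θ → ℝ≥0∞) (z.1 i, z.2) * likRatio r z.1 z.2 := fun i =>
    (hI.comp (((measurable_pi_apply i).comp measurable_fst).prodMk measurable_snd)).mul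
      (measurable_likRatio hr)
  have hΦ : Measurable (Function.uncurry Φ) := Finset.measurable_sum _ fun i _ => hterm i
  calc _ ≤ (Measure.pi fun _ : Fin n => P) {x | κ ≤ ∫⁻ θ in A, Φ x θ ∂π} :=
        measure_mono fun x hx => le_trans hx (setLIntegral_inter_exists_likRatio_le π hA hD x)
    _ ≤ (∫⁻ θ in A, ∫⁻ x, Φ x θ ∂(Measure.pi fun _ : Fin n => P) ∂π) / κ :=
        measure_le_setLIntegral_le_lintegral_lintegral_div _ π A hΦ hκ hκ'
    _ ≤ (∫⁻ θ in A, n * ∫⁻ y, D.indicator 1 (y, θ) * r y θ ∂P ∂π) / κ := by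
        refine ENNReal.div_le_div_right (setLIntegral_mono' hA fun θ hθ => ?_) κ
        have hsection : ∀ i : Fin n, Measurable fun x : Fin n → E =>
            D.indicator (1 : E × Θ → ℝ≥0∞) (x i, θ) * likRatio r x θ := fun i =>
          (hterm i).comp measurable_prodMk_right
        rw [lintegral_finsetSum _ fun i _ => hsection i]
        refine (Finset.sum_le_card_nsmul _ _ _ fun i _ => lintegral_eval_mul_prod_eval_le P
          (hI.comp measurable_prodMk_right) hr.of_uncurry_right (h θ hθ) i).trans_eq ?_
        simp
    _ = n * (∫⁻ θ in A, ∫⁻ y, D.indicator 1 (y, θ) * r y θ ∂P ∂π) / κ := by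
        rw [lintegral_const_mul _
          (Measurable.lintegral_prod_left' (f := fun z : E × Θ => D.indicator 1 z * r z.1 z.2)
            (hI.mul hr))]

end IntegratedLikelihoodRatio

section SquareRoots

variable {a b : ℝ}

lemma sq_sqrt_sub_sqrt_le_abs_sub (a b : ℝ) : (√a - √b) ^ 2 ≤ |a - b| := by
  wlog hab : b ≤ a generalizing a b
  · rw [← neg_sub (√b), neg_sq, abs_sub_comm]
    exact this b a (le_of_not_ge hab)
  have hsqrt : √b ≤ √a := Real.sqrt_le_sqrt hab
  rw [abs_of_nonneg (sub_nonneg.2 hab)]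
  rcases le_total 0 b with hb | hb
  · nlinarith [Real.sq_sqrt hb, Real.sq_sqrt (hb.trans hab), Real.sqrt_nonneg b]
  · rw [Real.sqrt_eq_zero_of_nonpos hb, sub_zero]
    rcases le_total 0 a with ha | ha
    · linarith [Real.sq_sqrt ha]
    · simpa [Real.sqrt_eq_zero_of_nonpos ha] using hab

lemma abs_sub_le_sq_sqrt_sub_sqrt (ha : 0 ≤ a) (hb : 0 ≤ b) {η : ℝ} (hη : 0 < η) :
    |a - b| ≤ (2 * η)⁻¹ * (√a - √b) ^ 2 + η * (a + b) := by
  have hfactor : |a - b| = |√a - √b| * (√a + √b) := by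
    rw [← abs_of_nonneg (by positivity : 0 ≤ √a + √b), ← abs_mul]
    congr 1
    linear_combination Real.sq_sqrt hb - Real.sq_sqrt ha
  have hsum : (√a + √b) ^ 2 ≤ 2 * (a + b) := by
    linarith [sq_nonneg (√a - √b), Real.sq_sqrt ha, Real.sq_sqrt hb, add_sq √a √b,
      sub_sq √a √b]
  have hyoung : |√a - √b| * (√a + √b) ≤ (2 * η)⁻¹ * |√a - √b| ^ 2 + η / 2 * (√a + √b) ^ 2 := by
    have hsq : 0 ≤ (2 * η)⁻¹ * (|√a - √b| - η * (√a + √b)) ^ 2 := by positivity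
    have hexpand : (2 * η)⁻¹ * (|√a - √b| - η * (√a + √b)) ^ 2 = (2 * η)⁻¹ * |√a - √b| ^ 2
        + η / 2 * (√a + √b) ^ 2 - |√a - √b| * (√a + √b) := by
      field_simp
      ring
    linarith
  rw [sq_abs] at hyoung
  linarith [mul_le_mul_of_nonneg_left hsum hη.le]

lemma sq_sqrt_mul_add_sub_sqrt_mul_add_le {c l : ℝ} (ha : 0 ≤ a) (hb : 0 ≤ b) (hc : 0 ≤ c)
    (hl : 0 ≤ l) : (√(l * a + c) - √(l * b + c)) ^ 2 ≤ l * (√a - √b) ^ 2 := by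
  have hcauchy : l * (√a * √b) + c ≤ √(l * a + c) * √(l * b + c) := by
    rw [← Real.sqrt_mul (by positivity : 0 ≤ l * a + c)]
    refine Real.le_sqrt_of_sq_le ?_
    have hamgm : 2 * (√a * √b) ≤ a + b := by
      linarith [sq_nonneg (√a - √b), sub_sq √a √b, Real.sq_sqrt ha, Real.sq_sqrt hb]
    calc (l * (√a * √b) + c) ^ 2
        = l ^ 2 * (√a ^ 2 * √b ^ 2) + l * c * (2 * (√a * √b)) + c ^ 2 := by ring
      _ ≤ l ^ 2 * (√a ^ 2 * √b ^ 2) + l * c * (a + b) + c ^ 2 := by gcongr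
      _ = (l * a + c) * (l * b + c) := by rw [Real.sq_sqrt ha, Real.sq_sqrt hb]; ring
  rw [sub_sq, sub_sq, Real.sq_sqrt ha, Real.sq_sqrt hb, Real.sq_sqrt (by positivity),
    Real.sq_sqrt (by positivity)]
  linarith

lemma sq_sub_le_of_two_mul_sq_eq {a b s : ℝ} (ha : 0 ≤ a) (hb : 0 ≤ b) (hs : 0 ≤ s)
    (h : 2 * b ^ 2 = a ^ 2 + s ^ 2) : (s - a) ^ 2 ≤ 16 * (b - a) ^ 2 := by
  have hbs : b ≤ s + a := by nlinarith [mul_nonneg hs ha]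
  have hfactor : (s - a) * (s + a) = 2 * ((b - a) * (b + a)) := by linarith
  rcases (add_nonneg hs ha).eq_or_lt with h0 | h0
  · obtain rfl : s = 0 := by linarith
    obtain rfl : a = 0 := by linarith
    nlinarith [sq_nonneg b]
  · refine le_of_mul_le_mul_right ?_ (pow_pos h0 2)
    calc (s - a) ^ 2 * (s + a) ^ 2 = 4 * ((b - a) ^ 2 * (b + a) ^ 2) := by
          rw [← mul_pow, hfactor]; ring
      _ ≤ 4 * ((b - a) ^ 2 * (2 * (s + a)) ^ 2) := by gcongr; linarith
      _ = 16 * (b - a) ^ 2 * (s + a) ^ 2 := by ring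

/-- The comparison behind the second-kind error of the Hellinger test, with `a`, `b`, `s`, `r` the
square roots of the null density, the midpoint, the centre of the alternative and a density near
that centre. At `b = 0` also `a = 0`, and `a / b = 0`. -/
lemma sq_mul_div_le_of_two_mul_sq_eq {a b s : ℝ} (ha : 0 ≤ a) (hb : 0 ≤ b)
    (h : 2 * b ^ 2 = a ^ 2 + s ^ 2) (r : ℝ) :
    r ^ 2 * (a / b) ≤ r ^ 2 + (a ^ 2 - b ^ 2) / 2 + 9 / 2 * (r - s) ^ 2 - (b - a) ^ 2 := by
  rcases hb.eq_or_lt with rfl | hb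
  · obtain rfl : a = 0 := by nlinarith [sq_nonneg s]
    obtain rfl : s = 0 := by nlinarith
    simp only [div_zero, mul_zero]
    nlinarith [sq_nonneg r]
  obtain ⟨v, rfl⟩ : ∃ v, a = v * b := ⟨a / b, by field_simp⟩
  have hv : 0 ≤ v := nonneg_of_mul_nonneg_left ha hb
  have hs : s ^ 2 = b ^ 2 * (2 - v ^ 2) := by linarith [mul_pow v b 2]
  have hv2 : v ≤ 3 / 2 := by
    have : v ^ 2 ≤ 2 := by nlinarith [sq_nonneg s, pow_pos hb 2]
    nlinarith
  have hcentre : s ^ 2 * v ≤ 3 * (v * b * b) - 2 * (v * b) ^ 2 := by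
    rw [hs]
    nlinarith [mul_nonneg (mul_nonneg hv (sq_nonneg b)) (sq_nonneg (v - 1))]
  have hcross : 2 * ((r - s) * (s * (v - 1))) ≤ 4 * (r - s) ^ 2 + 1 / 4 * (s * (v - 1)) ^ 2 := by
    nlinarith [sq_nonneg (2 * (r - s) - 1 / 2 * (s * (v - 1)))]
  have hcross' : (s * (v - 1)) ^ 2 ≤ 2 * (v * b - b) ^ 2 := by
    rw [mul_pow, hs]
    nlinarith [mul_nonneg (sq_nonneg b) (mul_nonneg (sq_nonneg v) (sq_nonneg (v - 1)))]
  have hnear : (r - s) ^ 2 * (v - 1) ≤ 1 / 2 * (r - s) ^ 2 := by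
    nlinarith [sq_nonneg (r - s)]
  rw [mul_div_cancel_right₀ _ hb.ne']
  nlinarith

end SquareRoots

section Hellinger

variable {E : Type*} [MeasurableSpace E] {μ : Measure E} {q r : E → ℝ}

/-- Squared Hellinger distance of two nonnegative functions with respect to `μ`; it is the square
of `hellinger X q r` when `μ` is Lebesgue measure on `X`. -/
noncomputable def hellingerSq (μ : Measure E) (q r : E → ℝ) : ℝ :=
  1 / 2 * ∫ x, (√(q x) - √(r x)) ^ 2 ∂μ

/-- `q` is a probability density with respect to `μ`. -/
structure IsDensity (μ : Measure E) (q : E → ℝ) : Prop where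
  integrable : Integrable q μ
  nonneg : 0 ≤ᵐ[μ] q
  integral_eq : ∫ x, q x ∂μ = 1

lemma IsDensity.congr (hq : IsDensity μ q) (h : q =ᵐ[μ] r) : IsDensity μ r where
  integrable := hq.integrable.congr h
  nonneg := hq.nonneg.trans_eq h
  integral_eq := by rw [← integral_congr_ae h, hq.integral_eq]

lemma IsDensity.mixture (hq : IsDensity μ q) (hr : IsDensity μ r) {t : ℝ} (ht : 0 ≤ t)
    (ht1 : t ≤ 1) : IsDensity μ fun x => (1 - t) * q x + t * r x where
  integrable := (hq.integrable.const_mul _).add (hr.integrable.const_mul _)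
  nonneg := by
    filter_upwards [hq.nonneg, hr.nonneg] with x hqx hrx
    exact add_nonneg (mul_nonneg (sub_nonneg.2 ht1) hqx) (mul_nonneg ht hrx)
  integral_eq := by
    rw [integral_add (hq.integrable.const_mul _) (hr.integrable.const_mul _),
      integral_const_mul, integral_const_mul, hq.integral_eq, hr.integral_eq]
    ring

lemma IsDensity.midpoint (hq : IsDensity μ q) (hr : IsDensity μ r) :
    IsDensity μ fun x => (q x + r x) / 2 := by
  convert hq.mixture hr (t := 1 / 2) (by norm_num) (by norm_num) using 2
  ring

lemma IsDensity.lintegral_eq_one (hq : IsDensity μ q) : ∫⁻ x, ENNReal.ofReal (q x) ∂μ = 1 := by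
  rw [← ofReal_integral_eq_lintegral_ofReal hq.integrable hq.nonneg, hq.integral_eq,
    ENNReal.ofReal_one]

lemma integrable_sq_sqrt_sub_sqrt (hq : Integrable q μ) (hr : Integrable r μ) :
    Integrable (fun x => (√(q x) - √(r x)) ^ 2) μ := by
  refine (hq.sub hr).abs.mono' ?_ (ae_of_all _ fun x => ?_)
  · exact ((Real.continuous_sqrt.comp_aestronglyMeasurable hq.1).sub
      (Real.continuous_sqrt.comp_aestronglyMeasurable hr.1)).pow 2
  · rw [Real.norm_of_nonneg (sq_nonneg _)]
    exact sq_sqrt_sub_sqrt_le_abs_sub _ _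

lemma hellingerSq_nonneg (q r : E → ℝ) : 0 ≤ hellingerSq μ q r :=
  mul_nonneg (by norm_num) (integral_nonneg fun _ => sq_nonneg _)

lemma hellingerSq_congr {q' r' : E → ℝ} (hq : q =ᵐ[μ] q') (hr : r =ᵐ[μ] r') :
    hellingerSq μ q r = hellingerSq μ q' r' := by
  unfold hellingerSq
  rw [integral_congr_ae]
  filter_upwards [hq, hr] with x hqx hrx
  rw [hqx, hrx]

lemma hellingerSq_le_of_bracket {L U : E → ℝ} (hL : Integrable L μ) (hU : Integrable U μ)
    (hq : ∀ᵐ x ∂μ, L x ≤ q x ∧ q x ≤ U x) (hr : ∀ᵐ x ∂μ, L x ≤ r x ∧ r x ≤ U x) :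
    hellingerSq μ q r ≤ hellingerSq μ L U := by
  refine mul_le_mul_of_nonneg_left (integral_mono_of_nonneg (ae_of_all _ fun _ => sq_nonneg _)
    (integrable_sq_sqrt_sub_sqrt hL hU) ?_) (by norm_num)
  filter_upwards [hq, hr] with x hqx hrx
  refine sq_le_sq.2 ?_
  rw [abs_sub_comm √(L x)]
  exact (abs_sub_le_of_le_of_le (Real.sqrt_le_sqrt hqx.1) (Real.sqrt_le_sqrt hqx.2)
    (Real.sqrt_le_sqrt hrx.1) (Real.sqrt_le_sqrt hrx.2)).trans (le_abs_self _)

lemma hellingerSq_mul_add_mul_add_le {s : E → ℝ} (hq : Integrable q μ) (hr : Integrable r μ)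
    (hq0 : 0 ≤ᵐ[μ] q) (hr0 : 0 ≤ᵐ[μ] r) (hs : 0 ≤ᵐ[μ] s) {l : ℝ} (hl : 0 ≤ l) :
    hellingerSq μ (fun x => l * q x + s x) (fun x => l * r x + s x) ≤ l * hellingerSq μ q r := by
  have h : ∫ x, (√(l * q x + s x) - √(l * r x + s x)) ^ 2 ∂μ
      ≤ ∫ x, l * (√(q x) - √(r x)) ^ 2 ∂μ := by
    refine integral_mono_of_nonneg (ae_of_all _ fun _ => sq_nonneg _)
      ((integrable_sq_sqrt_sub_sqrt hq hr).const_mul l) ?_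
    filter_upwards [hq0, hr0, hs] with x hqx hrx hsx
    exact sq_sqrt_mul_add_sub_sqrt_mul_add_le hqx hrx hsx hl
  rw [integral_const_mul] at h
  unfold hellingerSq
  linarith

lemma hellingerSq_le_half_integral_abs_sub (hq : Integrable q μ) (hr : Integrable r μ) :
    hellingerSq μ q r ≤ 1 / 2 * ∫ x, |q x - r x| ∂μ :=
  mul_le_mul_of_nonneg_left (integral_mono (integrable_sq_sqrt_sub_sqrt hq hr) (hq.sub hr).abs
    fun _ => sq_sqrt_sub_sqrt_le_abs_sub _ _) (by norm_num)

lemma IsDensity.integral_abs_sub_le (hq : IsDensity μ q) (hr : IsDensity μ r) {η : ℝ}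
    (hη : 0 < η) : ∫ x, |q x - r x| ∂μ ≤ η⁻¹ * hellingerSq μ q r + 2 * η := by
  have hsq := (integrable_sq_sqrt_sub_sqrt hq.integrable hr.integrable).const_mul (2 * η)⁻¹
  have hsum := (hq.integrable.fun_add hr.integrable).const_mul η
  calc ∫ x, |q x - r x| ∂μ
      ≤ ∫ x, ((2 * η)⁻¹ * (√(q x) - √(r x)) ^ 2 + η * (q x + r x)) ∂μ := by
        refine integral_mono_ae (hq.integrable.sub hr.integrable).abs (hsq.add hsum) ?_
        filter_upwards [hq.nonneg, hr.nonneg] with x hqx hrx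
        exact abs_sub_le_sq_sqrt_sub_sqrt hqx hrx hη
    _ = η⁻¹ * hellingerSq μ q r + 2 * η := by
        rw [integral_add hsq hsum, integral_const_mul, integral_const_mul,
          integral_add hq.integrable hr.integrable, hq.integral_eq, hr.integral_eq, hellingerSq]
        ring

lemma IsDensity.sqrt_mul_sqrt_ae_eq (hq : IsDensity μ q) (hr : IsDensity μ r) :
    (fun x => √(q x) * √(r x)) =ᵐ[μ] fun x => 1 / 2 * (q x + r x - (√(q x) - √(r x)) ^ 2) := by
  filter_upwards [hq.nonneg, hr.nonneg] with x hqx hrx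
  rw [sub_sq, Real.sq_sqrt hqx, Real.sq_sqrt hrx]
  ring

lemma IsDensity.integrable_sqrt_mul_sqrt (hq : IsDensity μ q) (hr : IsDensity μ r) :
    Integrable (fun x => √(q x) * √(r x)) μ :=
  (((hq.integrable.add hr.integrable).sub (integrable_sq_sqrt_sub_sqrt hq.integrable
    hr.integrable)).const_mul (1 / 2)).congr (hq.sqrt_mul_sqrt_ae_eq hr).symm

lemma IsDensity.integral_sqrt_mul_sqrt (hq : IsDensity μ q) (hr : IsDensity μ r) :
    ∫ x, √(q x) * √(r x) ∂μ = 1 - hellingerSq μ q r := by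
  rw [integral_congr_ae (hq.sqrt_mul_sqrt_ae_eq hr), integral_const_mul,
    integral_sub (hq.integrable.fun_add hr.integrable)
      (integrable_sq_sqrt_sub_sqrt hq.integrable hr.integrable),
    integral_add hq.integrable hr.integrable, hq.integral_eq, hr.integral_eq, hellingerSq]
  ring

lemma IsDensity.hellingerSq_le_one (hq : IsDensity μ q) (hr : IsDensity μ r) :
    hellingerSq μ q r ≤ 1 := by
  have h : 0 ≤ ∫ x, √(q x) * √(r x) ∂μ :=
    integral_nonneg fun x => mul_nonneg (Real.sqrt_nonneg _) (Real.sqrt_nonneg _)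
  rw [hq.integral_sqrt_mul_sqrt hr] at h
  linarith

/-- Scheffé's argument: `∫ |q i - r| = 2 ∫ (r - q i)⁺`, whose integrand is dominated by `r`. -/
lemma IsDensity.tendsto_hellingerSq {ι : Type*} {l : Filter ι} [l.IsCountablyGenerated]
    {q : ι → E → ℝ} (hq : ∀ᶠ i in l, IsDensity μ (q i)) (hr : IsDensity μ r)
    (hlim : ∀ᵐ x ∂μ, Tendsto (fun i => q i x) l (𝓝 (r x))) :
    Tendsto (fun i => hellingerSq μ (q i) r) l (𝓝 0) := by
  have hpos : Tendsto (fun i => ∫ x, max (r x - q i x) 0 ∂μ) l (𝓝 (∫ _, (0 : ℝ) ∂μ)) := by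
    refine tendsto_integral_filter_of_dominated_convergence r ?_ ?_ hr.integrable ?_
    · filter_upwards [hq] with i hi using (hr.integrable.sub hi.integrable).pos_part.1
    · filter_upwards [hq] with i hi
      filter_upwards [hi.nonneg, hr.nonneg] with x hix hrx
      rw [Real.norm_of_nonneg (le_max_right _ _)]
      exact max_le (sub_le_self _ hix) hrx
    · filter_upwards [hlim] with x hx
      simpa using (hx.const_sub (r x)).max (tendsto_const_nhds (x := (0 : ℝ)))
  rw [integral_zero] at hpos
  refine squeeze_zero' (Eventually.of_forall fun _ => hellingerSq_nonneg _ _) ?_ hpos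
  filter_upwards [hq] with i hi
  have hmax : Integrable (fun x => max (r x - q i x) 0) μ :=
    (hr.integrable.sub hi.integrable).pos_part
  have habs : ∀ x, |q i x - r x| = q i x - r x + 2 * max (r x - q i x) 0 := fun x => by
    rcases le_total (q i x) (r x) with h | h
    · rw [abs_of_nonpos (by linarith), max_eq_left (by linarith)]; ring
    · rw [abs_of_nonneg (by linarith), max_eq_right (by linarith)]; ring
  refine (hellingerSq_le_half_integral_abs_sub hi.integrable hr.integrable).trans_eq ?_
  simp only [habs]
  rw [integral_add (hi.integrable.sub' hr.integrable) (hmax.const_mul 2),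
    integral_sub hi.integrable hr.integrable, hi.integral_eq, hr.integral_eq, integral_const_mul]
  ring

variable {p q₁ : E → ℝ} {φ : ℝ}

lemma IsDensity.hellingerSq_le_sixteen_mul_midpoint (hp : IsDensity μ p) (hq : IsDensity μ q) :
    hellingerSq μ q p ≤ 16 * hellingerSq μ (fun x => (p x + q x) / 2) p := by
  have hmid := hp.midpoint hq
  have h : ∫ x, (√(q x) - √(p x)) ^ 2 ∂μ ≤ ∫ x, 16 * (√((p x + q x) / 2) - √(p x)) ^ 2 ∂μ := by
    refine integral_mono_ae (integrable_sq_sqrt_sub_sqrt hq.integrable hp.integrable)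
      ((integrable_sq_sqrt_sub_sqrt hmid.integrable hp.integrable).const_mul 16) ?_
    filter_upwards [hp.nonneg, hq.nonneg, hmid.nonneg] with x hpx hqx hmx
    refine sq_sub_le_of_two_mul_sq_eq (Real.sqrt_nonneg _) (Real.sqrt_nonneg _)
      (Real.sqrt_nonneg _) ?_
    rw [Real.sq_sqrt hpx, Real.sq_sqrt hqx, Real.sq_sqrt hmx]
    ring
  rw [integral_const_mul] at h
  unfold hellingerSq
  linarith

/-- First-kind error of the test of `p` against a neighbourhood of `q₁`. -/
lemma IsDensity.lintegral_sqrt_midpoint_mul_sqrt_le (hp : IsDensity μ p) (hq₁ : IsDensity μ q₁)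
    (hφ : φ ^ 2 ≤ hellingerSq μ q₁ p) :
    ∫⁻ x, ENNReal.ofReal (√((p x + q₁ x) / 2) * √(p x)) ∂μ
      ≤ ENNReal.ofReal (Real.exp (-(φ ^ 2 / 16))) := by
  have hmid := hp.midpoint hq₁
  rw [← ofReal_integral_eq_lintegral_ofReal (hmid.integrable_sqrt_mul_sqrt hp)
    (ae_of_all _ fun x => mul_nonneg (Real.sqrt_nonneg _) (Real.sqrt_nonneg _)),
    hmid.integral_sqrt_mul_sqrt hp]
  refine ENNReal.ofReal_le_ofReal ?_
  linarith [hp.hellingerSq_le_sixteen_mul_midpoint hq₁, Real.add_one_le_exp (-(φ ^ 2 / 16))]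

/-- Second-kind error of the test of `p` against a neighbourhood of `q₁`. -/
lemma IsDensity.lintegral_mul_sqrt_div_sqrt_midpoint_le (hp : IsDensity μ p)
    (hq₁ : IsDensity μ q₁) (hφ : φ ^ 2 ≤ hellingerSq μ q₁ p) (hq : IsDensity μ q)
    (hqq₁ : hellingerSq μ q q₁ ≤ (φ / 12) ^ 2) :
    ∫⁻ x, ENNReal.ofReal (q x * (√(p x) / √((p x + q₁ x) / 2))) ∂μ
      ≤ ENNReal.ofReal (Real.exp (-(φ ^ 2 / 16))) := by
  have hmid := hp.midpoint hq₁
  let R : E → ℝ := fun x => q x + (p x - (p x + q₁ x) / 2) / 2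
    + 9 / 2 * (√(q x) - √(q₁ x)) ^ 2 - (√((p x + q₁ x) / 2) - √(p x)) ^ 2
  have hle : (fun x => q x * (√(p x) / √((p x + q₁ x) / 2))) ≤ᵐ[μ] R := by
    filter_upwards [hp.nonneg, hq.nonneg, hq₁.nonneg, hmid.nonneg] with x hpx hqx hq₁x hmx
    have h := sq_mul_div_le_of_two_mul_sq_eq (s := √(q₁ x)) (Real.sqrt_nonneg (p x))
      (Real.sqrt_nonneg ((p x + q₁ x) / 2)) (by
        rw [Real.sq_sqrt hpx, Real.sq_sqrt hq₁x, Real.sq_sqrt hmx]; ring) √(q x)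
    rwa [Real.sq_sqrt hpx, Real.sq_sqrt hmx, Real.sq_sqrt hqx] at h
  have hR : Integrable R μ ∧
      ∫ x, R x ∂μ
        = 1 + 9 * hellingerSq μ q q₁ - 2 * hellingerSq μ (fun x => (p x + q₁ x) / 2) p := by
    have h₁ : Integrable (fun x => (p x - (p x + q₁ x) / 2) / 2) μ :=
      (hp.integrable.sub hmid.integrable).div_const 2
    have h₂ := (integrable_sq_sqrt_sub_sqrt hq.integrable hq₁.integrable).const_mul (9 / 2)
    have h₃ := integrable_sq_sqrt_sub_sqrt hmid.integrable hp.integrable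
    have h₁₂ := (hq.integrable.fun_add h₁).fun_add h₂
    refine ⟨h₁₂.sub h₃, ?_⟩
    rw [integral_sub h₁₂ h₃, integral_add (hq.integrable.fun_add h₁) h₂,
      integral_add hq.integrable h₁, integral_div, integral_sub hp.integrable hmid.integrable,
      hp.integral_eq, hq.integral_eq, hmid.integral_eq, integral_const_mul]
    simp only [hellingerSq]
    ring
  calc ∫⁻ x, ENNReal.ofReal (q x * (√(p x) / √((p x + q₁ x) / 2))) ∂μ
      ≤ ∫⁻ x, ENNReal.ofReal (R x) ∂μ :=
        lintegral_mono_ae (hle.mono fun _ hx => ENNReal.ofReal_le_ofReal hx)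
    _ = ENNReal.ofReal (∫ x, R x ∂μ) := by
        rw [ofReal_integral_eq_lintegral_ofReal hR.1]
        filter_upwards [hle, hq.nonneg] with x hx hqx
        exact (mul_nonneg hqx (div_nonneg (Real.sqrt_nonneg _) (Real.sqrt_nonneg _))).trans hx
    _ ≤ ENNReal.ofReal (Real.exp (-(φ ^ 2 / 16))) := by
        refine ENNReal.ofReal_le_ofReal ?_
        rw [hR.2]
        linarith [hp.hellingerSq_le_sixteen_mul_midpoint hq₁,
          Real.add_one_le_exp (-(φ ^ 2 / 16))]

end Hellinger

section RpowInequalities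

variable {a b c l α : ℝ}

/-- Convexity of `u ↦ u ^ (1 + α)` at the convex combination of `a / b` and `1` with weights
`l * b` and `c`. -/
lemma mul_div_rpow_le (ha : 0 ≤ a) (hb : 0 < b) (hc : 0 < c) (hl : 0 ≤ l) (hα : 0 < α) :
    (l * a + c) * ((l * a + c) / (l * b + c)) ^ α ≤ l * (a * (a / b) ^ α) + c := by
  have : 0 < l * b + c := by positivity
  have hn : 0 < l * a + c := by positivity
  have hconv := (convexOn_rpow (p := 1 + α) (by linarith)).2 (mem_Ici.2 (div_nonneg ha hb.le))
    (mem_Ici.2 zero_le_one) (by positivity : 0 ≤ l * b / (l * b + c))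
    (by positivity : 0 ≤ c / (l * b + c)) (by field_simp)
  simp only [smul_eq_mul, mul_one, Real.one_rpow] at hconv
  have hcomb : l * b / (l * b + c) * (a / b) + c / (l * b + c) = (l * a + c) / (l * b + c) := by
    field_simp
  have hpow : (a / b) ^ (1 + α) = a / b * (a / b) ^ α := by
    rcases ha.eq_or_lt with rfl | ha
    · simp [Real.zero_rpow (by linarith : 1 + α ≠ 0)]
    · rw [Real.rpow_add (by positivity), Real.rpow_one]
  rw [hcomb, hpow, Real.rpow_add (by positivity), Real.rpow_one] at hconv
  calc (l * a + c) * ((l * a + c) / (l * b + c)) ^ α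
      = (l * b + c) * ((l * a + c) / (l * b + c) * ((l * a + c) / (l * b + c)) ^ α) := by
        field_simp
    _ ≤ (l * b + c) * (l * b / (l * b + c) * (a / b * (a / b) ^ α) + c / (l * b + c)) := by
        gcongr
    _ = l * (a * (a / b) ^ α) + c := by field_simp

/-- With division in `ℝ≥0∞`, the right side is infinite at `b = 0 < a`, as in the definition of
`ρ`. -/
lemma ofReal_mul_div_rpow_le (ha : 0 ≤ a) (hb : 0 ≤ b) (hc : 0 < c) (hl : 0 ≤ l) (hα : 0 < α) :
    ENNReal.ofReal ((l * a + c) * ((l * a + c) / (l * b + c)) ^ α)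
      ≤ ENNReal.ofReal l * ((ENNReal.ofReal a / ENNReal.ofReal b) ^ α * ENNReal.ofReal a)
        + ENNReal.ofReal c := by
  rcases hb.eq_or_lt with rfl | hb
  · rcases (mul_nonneg hl ha).eq_or_lt with hla | hla
    · simp [← hla, div_self hc.ne']
    · have hl0 : 0 < l := pos_of_mul_pos_left hla ha
      have ha0 : 0 < a := pos_of_mul_pos_right hla hl
      simp [ENNReal.div_zero, ha0, hl0, hα, ENNReal.top_mul, ENNReal.mul_top]
  · rw [← ENNReal.ofReal_div_of_pos hb, ENNReal.ofReal_rpow_of_nonneg (by positivity) hα.le,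
      ← ENNReal.ofReal_mul (by positivity), ← ENNReal.ofReal_mul hl,
      ← ENNReal.ofReal_add (by positivity) hc.le, mul_comm ((a / b) ^ α) a]
    exact ENNReal.ofReal_le_ofReal (mul_div_rpow_le ha hb hc hl hα)

end RpowInequalities

lemma sq_hellinger {m : ℕ} (X : Set (EuclideanSpace ℝ (Fin m)))
    (q r : EuclideanSpace ℝ (Fin m) → ℝ) :
    hellinger X q r ^ 2 = hellingerSq (volume.restrict X) q r :=
  Real.sq_sqrt (hellingerSq_nonneg q r)

namespace ContaminationModel

variable {m d : ℕ} {M : ContaminationModel m d} {p : ℝ} {x : EuclideanSpace ℝ (Fin m)}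
  {θ θ' : EuclideanSpace ℝ (Fin d)}

lemma isDensity_f (hθ : θ ∈ M.par) : IsDensity (volume.restrict M.obs) fun x => M.f x θ where
  integrable := Integrable.of_integral_ne_zero (by rw [M.integral_f θ hθ]; exact one_ne_zero)
  nonneg := by
    filter_upwards [ae_restrict_mem M.measurableSet_obs] with x hx using M.f_nonneg x hx θ hθ
  integral_eq := M.integral_f θ hθ

lemma isDensity_g : IsDensity (volume.restrict M.obs) M.g where
  integrable := Integrable.of_integral_ne_zero (by rw [M.integral_g]; exact one_ne_zero)
  nonneg := by
    filter_upwards [ae_restrict_mem M.measurableSet_obs] with x hx using (M.g_pos x hx).le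
  integral_eq := M.integral_g

lemma isDensity_k (hp : 0 ≤ p) (hp1 : p ≤ 1) (hθ : θ ∈ M.par) :
    IsDensity (volume.restrict M.obs) fun x => M.k p x θ :=
  (isDensity_f hθ).mixture isDensity_g hp hp1

lemma k_zero (x : EuclideanSpace ℝ (Fin m)) (θ : EuclideanSpace ℝ (Fin d)) :
    M.k 0 x θ = M.f x θ := by simp [k]

lemma k_pos (hp : 0 < p) (hp1 : p ≤ 1) (hx : x ∈ M.obs) (hθ : θ ∈ M.par) : 0 < M.k p x θ :=
  add_pos_of_nonneg_of_pos (mul_nonneg (sub_nonneg.2 hp1) (M.f_nonneg x hx θ hθ))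
    (mul_pos hp (M.g_pos x hx))

lemma continuousOn_k (M : ContaminationModel m d) (p : ℝ) :
    ContinuousOn (fun z : EuclideanSpace ℝ (Fin m) × EuclideanSpace ℝ (Fin d) => M.k p z.1 z.2)
      (M.obs ×ˢ M.par) :=
  (continuousOn_const.mul M.continuousOn_f).add
    (continuousOn_const.mul (M.continuousOn_g.comp continuousOn_fst fun _ hz => hz.1))

open Classical in
/-- The contaminated likelihood extended by `1` off the observation and parameter spaces, which
makes it measurable and, for `p > 0`, positive everywhere. -/
noncomputable def kExt (M : ContaminationModel m d) (p : ℝ) (x : EuclideanSpace ℝ (Fin m))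
    (θ : EuclideanSpace ℝ (Fin d)) : ℝ :=
  (M.obs ×ˢ M.par).piecewise (fun z => M.k p z.1 z.2) 1 (x, θ)

open Classical in
lemma kExt_of_mem (hx : x ∈ M.obs) (hθ : θ ∈ M.par) : M.kExt p x θ = M.k p x θ :=
  piecewise_eq_of_mem _ _ _ (mk_mem_prod hx hθ)

open Classical in
lemma kExt_pos (hp : 0 < p) (hp1 : p ≤ 1) (x : EuclideanSpace ℝ (Fin m))
    (θ : EuclideanSpace ℝ (Fin d)) : 0 < M.kExt p x θ := by
  by_cases h : (x, θ) ∈ M.obs ×ˢ M.par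
  · rw [kExt_of_mem h.1 h.2]
    exact k_pos hp hp1 h.1 h.2
  · rw [kExt, piecewise_eq_of_notMem _ _ _ h]
    exact one_pos

lemma kExt_ae_eq (hθ : θ ∈ M.par) :
    (fun x => M.kExt p x θ) =ᵐ[volume.restrict M.obs] fun x => M.k p x θ := by
  filter_upwards [ae_restrict_mem M.measurableSet_obs] with x hx using kExt_of_mem hx hθ

lemma measurable_kExt : Measurable (Function.uncurry (M.kExt p)) := by
  classical
  exact (M.continuousOn_k p).measurable_piecewise continuousOn_const
    (M.measurableSet_obs.prod M.measurableSet_par)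

lemma measurable_kExt_left (θ : EuclideanSpace ℝ (Fin d)) : Measurable fun x => M.kExt p x θ :=
  measurable_kExt.of_uncurry_right

lemma isDensity_kExt (hp : 0 ≤ p) (hp1 : p ≤ 1) (hθ : θ ∈ M.par) :
    IsDensity (volume.restrict M.obs) fun x => M.kExt p x θ :=
  (isDensity_k hp hp1 hθ).congr (kExt_ae_eq hθ).symm

lemma dataLaw_eq : M.dataLaw p =
    (volume.restrict M.obs).withDensity fun x => ENNReal.ofReal (M.kExt p x M.θstar) := by
  refine withDensity_congr_ae ?_
  filter_upwards [kExt_ae_eq (p := p) M.θstar_mem] with x hx using by rw [hx]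

lemma isProbabilityMeasure_dataLaw (hp : 0 ≤ p) (hp1 : p ≤ 1) :
    IsProbabilityMeasure (M.dataLaw p) := by
  refine ⟨?_⟩
  rw [dataLaw_eq, withDensity_apply _ MeasurableSet.univ, Measure.restrict_univ,
    (isDensity_kExt hp hp1 M.θstar_mem).lintegral_eq_one]

lemma lintegral_dataLaw {h : EuclideanSpace ℝ (Fin m) → ℝ≥0∞} (hh : Measurable h) :
    ∫⁻ x, h x ∂M.dataLaw p = ∫⁻ x in M.obs, ENNReal.ofReal (M.kExt p x M.θstar) * h x := by
  rw [dataLaw_eq, lintegral_withDensity_eq_lintegral_mul _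
    (measurable_kExt_left M.θstar).ennreal_ofReal hh]
  rfl

/-- Likelihood ratio of one observation against the true parameter, built from `kExt`. -/
noncomputable def ratio (M : ContaminationModel m d) (p : ℝ) (x : EuclideanSpace ℝ (Fin m))
    (θ : EuclideanSpace ℝ (Fin d)) : ℝ≥0∞ :=
  ENNReal.ofReal (M.kExt p x θ) / ENNReal.ofReal (M.kExt p x M.θstar)

lemma ofReal_kExt_ne_zero (hp : 0 < p) (hp1 : p ≤ 1) (x : EuclideanSpace ℝ (Fin m))
    (θ : EuclideanSpace ℝ (Fin d)) : ENNReal.ofReal (M.kExt p x θ) ≠ 0 := by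
  simpa using kExt_pos hp hp1 x θ

lemma measurable_ratio : Measurable (Function.uncurry (M.ratio p)) :=
  measurable_kExt.ennreal_ofReal.div
    (((measurable_kExt_left (M := M) (p := p) M.θstar).comp measurable_fst).ennreal_ofReal)

lemma ratio_ne_zero (hp : 0 < p) (hp1 : p ≤ 1) (x : EuclideanSpace ℝ (Fin m))
    (θ : EuclideanSpace ℝ (Fin d)) : M.ratio p x θ ≠ 0 :=
  ENNReal.div_ne_zero.2 ⟨ofReal_kExt_ne_zero hp hp1 x θ, ENNReal.ofReal_ne_top⟩

lemma lintegral_ratio_mul (hp : 0 < p) (hp1 : p ≤ 1) (θ : EuclideanSpace ℝ (Fin d))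
    {h : EuclideanSpace ℝ (Fin m) → ℝ≥0∞} (hh : Measurable h) :
    ∫⁻ x, M.ratio p x θ * h x ∂M.dataLaw p
      = ∫⁻ x in M.obs, ENNReal.ofReal (M.kExt p x θ) * h x := by
  rw [lintegral_dataLaw (h := fun x => M.ratio p x θ * h x)
    (measurable_ratio.of_uncurry_right.mul hh)]
  refine lintegral_congr fun x => ?_
  rw [← mul_assoc, ratio, ENNReal.mul_div_cancel (ofReal_kExt_ne_zero hp hp1 x _)
    ENNReal.ofReal_ne_top]

lemma lintegral_ratio (hp : 0 < p) (hp1 : p ≤ 1) (hθ : θ ∈ M.par) :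
    ∫⁻ x, M.ratio p x θ ∂M.dataLaw p = 1 := by
  have h := lintegral_ratio_mul (M := M) hp hp1 θ (h := 1) measurable_one
  simpa [(isDensity_kExt hp.le hp1 hθ).lintegral_eq_one] using h

lemma ofReal_kExt_mul_inv_ratio_rpow (hp : 0 < p) (hp1 : p ≤ 1) (α : ℝ) (hx : x ∈ M.obs)
    (hθ : θ ∈ M.par) : ENNReal.ofReal (M.kExt p x M.θstar) * (M.ratio p x θ)⁻¹ ^ α
      = ENNReal.ofReal (M.k p x M.θstar * (M.k p x M.θstar / M.k p x θ) ^ α) := by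
  have hk := k_pos hp hp1 hx hθ
  have hkstar := k_pos hp hp1 hx M.θstar_mem
  rw [ratio, ENNReal.inv_div (Or.inl ENNReal.ofReal_ne_top)
    (Or.inl (ofReal_kExt_ne_zero hp hp1 _ _)), kExt_of_mem hx hθ, kExt_of_mem hx M.θstar_mem,
    ← ENNReal.ofReal_div_of_pos hk, ENNReal.ofReal_rpow_of_pos (div_pos hkstar hk),
    ← ENNReal.ofReal_mul hkstar.le]

lemma lintegral_div_rpow_mul_le_of_mem_rhoBall {α t : ℝ} (hα : 0 < α)
    (hθ : θ ∈ M.rhoBall p α t) :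
    ∫⁻ x in M.obs, (ENNReal.ofReal (M.k p x M.θstar) / ENNReal.ofReal (M.k p x θ)) ^ α *
      ENNReal.ofReal (M.k p x M.θstar) ≤ ENNReal.ofReal (1 + α * t) := by
  have hrho : M.rho p α M.θstar θ ≤ (t : EReal) := hθ.2
  unfold rho at hrho
  generalize ∫⁻ x in M.obs, (ENNReal.ofReal (M.k p x M.θstar) / ENNReal.ofReal (M.k p x θ)) ^ α *
    ENNReal.ofReal (M.k p x M.θstar) = I at hrho ⊢
  rcases eq_or_ne I ∞ with rfl | hI
  · have htop : ((∞ : ℝ≥0∞) : EReal) - 1 = ⊤ := by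
      rw [EReal.coe_ennreal_top]
      exact EReal.top_sub_coe 1
    rw [htop, EReal.coe_mul_top_of_pos (by positivity)] at hrho
    simp at hrho
  · rw [← EReal.coe_ennreal_toReal hI, ← EReal.coe_one, ← EReal.coe_sub, ← EReal.coe_mul,
      EReal.coe_le_coe_iff, one_div, inv_mul_le_iff₀ hα] at hrho
    rw [← ENNReal.ofReal_toReal hI]
    exact ENNReal.ofReal_le_ofReal (by linarith)

lemma lintegral_inv_ratio_rpow_le (hp : 0 < p) (hp1 : p ≤ 1) {α t : ℝ} (hα : 0 < α) (ht : 0 ≤ t)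
    (hθ : θ ∈ M.rhoBall 0 α t) :
    ∫⁻ x, (M.ratio p x θ)⁻¹ ^ α ∂M.dataLaw p ≤ ENNReal.ofReal (Real.exp (α * t)) := by
  have hl : 0 ≤ 1 - p := sub_nonneg.2 hp1
  have hg : IsDensity (volume.restrict M.obs) M.g := isDensity_g
  rw [lintegral_dataLaw (h := fun x => (M.ratio p x θ)⁻¹ ^ α)
    (measurable_ratio.of_uncurry_right.inv.pow_const α)]
  calc ∫⁻ x in M.obs, ENNReal.ofReal (M.kExt p x M.θstar) * (M.ratio p x θ)⁻¹ ^ α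
      ≤ ∫⁻ x in M.obs, (ENNReal.ofReal (1 - p) * ((ENNReal.ofReal (M.k 0 x M.θstar) /
        ENNReal.ofReal (M.k 0 x θ)) ^ α * ENNReal.ofReal (M.k 0 x M.θstar))
        + ENNReal.ofReal (p * M.g x)) := by
        refine setLIntegral_mono' M.measurableSet_obs fun x hx => ?_
        rw [ofReal_kExt_mul_inv_ratio_rpow hp hp1 α hx hθ.1]
        simp only [k_zero]
        exact ofReal_mul_div_rpow_le (M.f_nonneg x hx _ M.θstar_mem) (M.f_nonneg x hx θ hθ.1)
          (mul_pos hp (M.g_pos x hx)) hl hα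
    _ = ENNReal.ofReal (1 - p) * (∫⁻ x in M.obs, (ENNReal.ofReal (M.k 0 x M.θstar) /
        ENNReal.ofReal (M.k 0 x θ)) ^ α * ENNReal.ofReal (M.k 0 x M.θstar))
        + ENNReal.ofReal p := by
        rw [lintegral_add_right' _ (hg.integrable.const_mul p).1.aemeasurable.ennreal_ofReal,
          lintegral_const_mul' _ _ ENNReal.ofReal_ne_top]
        simp only [ENNReal.ofReal_mul hp.le]
        rw [lintegral_const_mul' _ _ ENNReal.ofReal_ne_top, hg.lintegral_eq_one, mul_one]
    _ ≤ ENNReal.ofReal (1 - p) * ENNReal.ofReal (1 + α * t) + ENNReal.ofReal p := by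
        gcongr
        exact lintegral_div_rpow_mul_le_of_mem_rhoBall hα hθ
    _ ≤ ENNReal.ofReal (Real.exp (α * t)) := by
        rw [← ENNReal.ofReal_mul hl, ← ENNReal.ofReal_add (by positivity) hp.le]
        refine ENNReal.ofReal_le_ofReal ?_
        linarith [Real.add_one_le_exp (α * t), mul_nonneg hp.le (mul_nonneg hα.le ht)]

lemma hell_nonneg (θ θ' : EuclideanSpace ℝ (Fin d)) : 0 ≤ M.hell p θ θ' := Real.sqrt_nonneg _

lemma hell_self (θ : EuclideanSpace ℝ (Fin d)) : M.hell p θ θ = 0 := by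
  simp [hell, hellinger]

lemma sq_hell (θ θ' : EuclideanSpace ℝ (Fin d)) : M.hell p θ θ' ^ 2
    = hellingerSq (volume.restrict M.obs) (fun x => M.k p x θ) fun x => M.k p x θ' :=
  sq_hellinger _ _ _

lemma sq_hell_eq_hellingerSq_kExt (hθ : θ ∈ M.par) (hθ' : θ' ∈ M.par) : M.hell p θ θ' ^ 2
    = hellingerSq (volume.restrict M.obs) (fun x => M.kExt p x θ) fun x => M.kExt p x θ' :=
  (sq_hell θ θ').trans (hellingerSq_congr (kExt_ae_eq hθ).symm (kExt_ae_eq hθ').symm)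

lemma measurableSet_lt_hell {φ : ℝ} (hφ : 0 ≤ φ) :
    MeasurableSet (M.par ∩ {θ | φ < M.hell p θ M.θstar}) := by
  have h : M.par ∩ {θ | φ < M.hell p θ M.θstar} = M.par ∩ {θ | φ ^ 2 < hellingerSq
      (volume.restrict M.obs) (fun x => M.kExt p x θ) fun x => M.kExt p x M.θstar} := by
    ext θ
    refine and_congr_right fun hθ => ?_
    rw [mem_ofPred_eq, mem_ofPred_eq, ← sq_hell_eq_hellingerSq_kExt hθ M.θstar_mem,
      sq_lt_sq₀ hφ (hell_nonneg _ _)]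
  have hmeas : Measurable fun z : EuclideanSpace ℝ (Fin d) × EuclideanSpace ℝ (Fin m) =>
      (√(M.kExt p z.2 z.1) - √(M.kExt p z.2 M.θstar)) ^ 2 :=
    ((measurable_kExt.comp measurable_swap).sqrt.sub
      ((measurable_kExt_left M.θstar).comp measurable_snd).sqrt).pow_const 2
  rw [h]
  exact M.measurableSet_par.inter (measurableSet_lt measurable_const (measurable_const.mul
    (hmeas.stronglyMeasurable.integral_prod_right (ν := volume.restrict M.obs)).measurable))

lemma hell_le_one (hp : 0 ≤ p) (hp1 : p ≤ 1) (hθ : θ ∈ M.par) (hθ' : θ' ∈ M.par) :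
    M.hell p θ θ' ≤ 1 := by
  rw [← abs_of_nonneg (hell_nonneg (M := M) (p := p) θ θ'), ← sq_le_one_iff_abs_le_one, sq_hell]
  exact (isDensity_k hp hp1 hθ).hellingerSq_le_one (isDensity_k hp hp1 hθ')

lemma hell_le_hell_zero (hp : 0 ≤ p) (hp1 : p ≤ 1) (hθ : θ ∈ M.par) (hθ' : θ' ∈ M.par) :
    M.hell p θ θ' ≤ M.hell 0 θ θ' := by
  have hf := isDensity_f hθ
  have hf' := isDensity_f hθ'
  rw [← sq_le_sq₀ (hell_nonneg _ _) (hell_nonneg _ _), sq_hell, sq_hell]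
  simp only [k_zero]
  refine (hellingerSq_mul_add_mul_add_le hf.integrable hf'.integrable hf.nonneg hf'.nonneg
    (s := fun x => p * M.g x) ?_ (sub_nonneg.2 hp1)).trans
    (mul_le_of_le_one_left (hellingerSq_nonneg _ _) (by linarith))
  filter_upwards [(isDensity_g (M := M)).nonneg] with x hx using mul_nonneg hp hx

/-- The bound passes through the `L¹` distances, which are proportional for `k_p` and `f`. -/
lemma hell_zero_sq_le (hp : 0 ≤ p) (hp1 : p ≤ 1) (hθ : θ ∈ M.par) (hθ' : θ' ∈ M.par) {φ : ℝ}
    (hφ : 0 < φ) (h : M.hell p θ θ' ≤ φ) : (1 - p) * M.hell 0 θ θ' ^ 2 ≤ 3 / 2 * φ := by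
  have hprop : ∫ x in M.obs, |M.k p x θ - M.k p x θ'|
      = (1 - p) * ∫ x in M.obs, |M.f x θ - M.f x θ'| := by
    rw [← integral_const_mul]
    refine integral_congr_ae (ae_of_all _ fun x => ?_)
    simp only [k]
    rw [add_sub_add_right_eq_sub, ← mul_sub, abs_mul, abs_of_nonneg (sub_nonneg.2 hp1)]
  have hzero : M.hell 0 θ θ' ^ 2 ≤ 1 / 2 * ∫ x in M.obs, |M.f x θ - M.f x θ'| := by
    rw [sq_hell]
    simp only [k_zero]
    exact hellingerSq_le_half_integral_abs_sub (isDensity_f hθ).integrable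
      (isDensity_f hθ').integrable
  have hsmall : ∫ x in M.obs, |M.k p x θ - M.k p x θ'| ≤ 3 * φ :=
    calc _ ≤ φ⁻¹ * M.hell p θ θ' ^ 2 + 2 * φ := by
          rw [sq_hell]
          exact (isDensity_k hp hp1 hθ).integral_abs_sub_le (isDensity_k hp hp1 hθ') hφ
      _ ≤ φ⁻¹ * φ ^ 2 + 2 * φ := by gcongr; exact hell_nonneg _ _
      _ = 3 * φ := by field_simp; ring
  rw [hprop] at hsmall
  nlinarith [mul_le_mul_of_nonneg_left hzero (sub_nonneg.2 hp1)]

section RadiusBound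

variable {ι : Type*} {l : Filter ι} {φ p : ι → ℝ} {p₀ : ℝ}

lemma eventually_radiusBound (hid : M.IdentifiabilityAssumption) (hφ : ∀ᶠ i in l, 0 < φ i)
    (hφ0 : Tendsto φ l (𝓝 0)) (hp₀ : p₀ < 1) (hp : ∀ᶠ i in l, 0 ≤ p i ∧ p i ≤ p₀) {ψ : ℝ}
    (hψ : 0 < ψ) : ∀ᶠ i in l, M.RadiusBound (p i) (φ i) ψ := by
  obtain ⟨η, hη, hsep⟩ := hid ψ hψ
  have hlim : 0 < (1 - p₀) * η ^ 2 / 2 := by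
    have : 0 < 1 - p₀ := sub_pos.2 hp₀
    positivity
  filter_upwards [hφ, hφ0.eventually (gt_mem_nhds hlim), hp] with i hi hiη hpi θ hθ hθφ
  by_contra hfar
  have hball := hell_zero_sq_le hpi.1 (hpi.2.trans hp₀.le) hθ M.θstar_mem hi hθφ
  have : (1 - p₀) * η ^ 2 ≤ (1 - p i) * M.hell 0 θ M.θstar ^ 2 := by
    gcongr
    · linarith [hpi.2]
    · exact hpi.2
    · exact hsep θ hθ (not_le.1 hfar)
  linarith

lemma exists_tendsto_radiusBound (hid : M.IdentifiabilityAssumption) (hφ : ∀ᶠ i in l, 0 < φ i)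
    (hφ0 : Tendsto φ l (𝓝 0)) (hp₀ : p₀ < 1) (hp : ∀ᶠ i in l, 0 ≤ p i ∧ p i ≤ p₀) :
    ∃ ψ : ι → ℝ, Tendsto ψ l (𝓝 0) ∧ ∀ᶠ i in l, M.RadiusBound (p i) (φ i) (ψ i) := by
  let D : ι → Set ℝ := fun i =>
    (fun θ => ‖θ - M.θstar‖) '' {θ | θ ∈ M.par ∧ M.hell (p i) θ M.θstar ≤ φ i}
  have hD : ∀ {ψ : ℝ} {i}, M.RadiusBound (p i) (φ i) ψ → ∀ s ∈ D i, s ≤ ψ := by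
    rintro ψ i h _ ⟨θ, hθ, rfl⟩
    exact h θ hθ.1 hθ.2
  have hD0 : ∀ i, 0 ≤ sSup (D i) := fun i =>
    Real.sSup_nonneg (by rintro _ ⟨θ, _, rfl⟩; exact norm_nonneg _)
  refine ⟨fun i => sSup (D i), tendsto_order.2 ⟨fun ε hε => ?_, fun ε hε => ?_⟩, ?_⟩
  · exact Eventually.of_forall fun i => hε.trans_le (hD0 i)
  · filter_upwards [eventually_radiusBound hid hφ hφ0 hp₀ hp (half_pos hε)] with i hi
    exact (Real.sSup_le (hD hi) (half_pos hε).le).trans_lt (half_lt_self hε)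
  · filter_upwards [eventually_radiusBound hid hφ hφ0 hp₀ hp one_pos] with i hi θ hθ hθφ
    exact le_csSup ⟨1, hD hi⟩ ⟨θ, ⟨hθ, hθφ⟩, rfl⟩

end RadiusBound

lemma exists_ne_hell_le (hp : 0 ≤ p) (hp1 : p ≤ 1) (hpar : M.par.Nontrivial) {φ : ℝ}
    (hφ : 0 < φ) : ∃ θ ∈ M.par, θ ≠ M.θstar ∧ M.hell p θ M.θstar ≤ φ := by
  have hacc : (𝓝[≠] M.θstar ⊓ 𝓟 M.par).NeBot :=
    M.convex_par.isPreconnected.preperfect_of_nontrivial hpar M.θstar M.θstar_mem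
  have hmem : ∀ᶠ θ in 𝓝[≠] M.θstar ⊓ 𝓟 M.par, θ ∈ M.par :=
    mem_inf_of_right (mem_principal_self _)
  have hlim : Tendsto (fun θ => M.hell p θ M.θstar ^ 2) (𝓝[≠] M.θstar ⊓ 𝓟 M.par) (𝓝 0) := by
    simp only [sq_hell]
    refine IsDensity.tendsto_hellingerSq (hmem.mono fun θ => isDensity_k hp hp1)
      (isDensity_k hp hp1 M.θstar_mem) ?_
    filter_upwards [ae_restrict_mem M.measurableSet_obs] with x hx
    have hcurve : Tendsto (fun θ => (x, θ)) (𝓝[≠] M.θstar ⊓ 𝓟 M.par)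
        (𝓝[M.obs ×ˢ M.par] (x, M.θstar)) :=
      tendsto_nhdsWithin_iff.2 ⟨tendsto_const_nhds.prodMk_nhds
        (tendsto_id.mono_left (inf_le_left.trans inf_le_left)), hmem.mono fun θ hθ => ⟨hx, hθ⟩⟩
    exact (M.continuousOn_k p (x, M.θstar) ⟨hx, M.θstar_mem⟩).tendsto.comp hcurve
  obtain ⟨θ, hθφ, hθ, hne⟩ := ((hlim.eventually (gt_mem_nhds (pow_pos hφ 2))).and
    (hmem.and (mem_inf_of_left self_mem_nhdsWithin))).exists
  exact ⟨θ, hθ, hne, (lt_of_pow_lt_pow_left₀ 2 hφ.le hθφ).le⟩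

end ContaminationModel

section Bracketing

variable {m : ℕ} {X : Set (EuclideanSpace ℝ (Fin m))}
  {𝒬 𝒬' : Set (EuclideanSpace ℝ (Fin m) → ℝ)} {a b r r' : ℝ} {n N : ℕ}

lemma HasBracketing.mono (h : HasBracketing X r 𝒬 N) (hr : r ≤ r') (h𝒬 : 𝒬' ⊆ 𝒬) :
    HasBracketing X r' 𝒬' N := by
  obtain ⟨L, U, hLU, hcover⟩ := h
  refine ⟨L, U, fun j => ?_, fun q hq => hcover q (h𝒬 hq)⟩
  obtain ⟨hL, hU, hL0, hU0, hw⟩ := hLU j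
  exact ⟨hL, hU, hL0, hU0, hw.trans hr⟩

lemma hasBracketing_toNat_bracketingNumber (h : bracketingNumber X r 𝒬 ≠ ⊤) :
    HasBracketing X r 𝒬 (bracketingNumber X r 𝒬).toNat := by
  classical
  have hex : ∃ N, HasBracketing X r 𝒬 N := by
    by_contra! hnone
    exact h (by simp [bracketingNumber, hnone])
  have hfind : bracketingNumber X r 𝒬 = (Nat.find hex : ℕ) :=
    le_antisymm (iInf₂_le _ (Nat.find_spec hex)) (le_iInf₂ fun N hN => by
      exact_mod_cast Nat.find_min' hex hN)
  rw [hfind, ENat.toNat_natCast]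
  exact Nat.find_spec hex

lemma bracketingNumber_anti (hr : r ≤ r') : bracketingNumber X r' 𝒬 ≤ bracketingNumber X r 𝒬 :=
  le_iInf₂ fun N hN => iInf₂_le N (hN.mono hr Subset.rfl)

lemma sqrtBracketingEntropy_anti (hr : r ≤ r') :
    sqrtBracketingEntropy X r' 𝒬 ≤ sqrtBracketingEntropy X r 𝒬 := by
  have hle := bracketingNumber_anti (X := X) (𝒬 := 𝒬) hr
  unfold sqrtBracketingEntropy
  by_cases h : bracketingNumber X r 𝒬 = ⊤
  · simp [h]
  · rw [if_neg h, if_neg (ne_top_of_le_ne_top h hle)]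
    refine ENNReal.ofReal_le_ofReal (Real.sqrt_le_sqrt ?_)
    rcases Nat.eq_zero_or_pos (bracketingNumber X r' 𝒬).toNat with h0 | h0
    · simpa [h0] using Real.log_natCast_nonneg _
    · exact Real.log_le_log (mod_cast h0) (mod_cast ENat.toNat_le_toNat hle h)

lemma sqrtBracketingEntropy_mul_le_setLIntegral (hrb : r ≤ b) :
    sqrtBracketingEntropy X r 𝒬 * ENNReal.ofReal (r - a)
      ≤ ∫⁻ u in Ioc a b, sqrtBracketingEntropy X u 𝒬 :=
  calc sqrtBracketingEntropy X r 𝒬 * ENNReal.ofReal (r - a)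
      = ∫⁻ _ in Ioc a r, sqrtBracketingEntropy X r 𝒬 := by simp
    _ ≤ ∫⁻ u in Ioc a r, sqrtBracketingEntropy X u 𝒬 :=
      setLIntegral_mono' measurableSet_Ioc fun u hu => sqrtBracketingEntropy_anti hu.2
    _ ≤ ∫⁻ u in Ioc a b, sqrtBracketingEntropy X u 𝒬 :=
      lintegral_mono_set (Ioc_subset_Ioc_right hrb)

lemma exists_hasBracketing_le_exp_sq {s : ℝ} (hs : 0 ≤ s)
    (h : sqrtBracketingEntropy X r 𝒬 ≤ ENNReal.ofReal s) :
    ∃ N : ℕ, HasBracketing X r 𝒬 N ∧ (N : ℝ) ≤ Real.exp (s ^ 2) := by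
  have htop : bracketingNumber X r 𝒬 ≠ ⊤ := by
    intro htop
    rw [sqrtBracketingEntropy, if_pos htop] at h
    exact ENNReal.ofReal_ne_top (top_le_iff.1 h)
  refine ⟨_, hasBracketing_toNat_bracketingNumber htop, ?_⟩
  rw [sqrtBracketingEntropy, if_neg htop, ENNReal.ofReal_le_ofReal_iff hs,
    Real.sqrt_le_left hs] at h
  exact (Real.le_exp_log _).trans (Real.exp_le_exp.2 h)

lemma exists_hasBracketing_le_exp_of_setLIntegral_le {c φ : ℝ} (hc : c ≤ 1 / 100) (hφ : 0 < φ)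
    (hφ1 : φ ≤ 1) (h : ∫⁻ u in Ioc (φ ^ 2 / 2 ^ 10) φ, sqrtBracketingEntropy X u 𝒬
      ≤ ENNReal.ofReal (c * √n * φ ^ 2)) :
    ∃ N : ℕ, HasBracketing X (φ / 12) 𝒬 N ∧ (N : ℝ) ≤ Real.exp (n * (φ ^ 2 / 32)) := by
  have hlen : φ / 16 ≤ φ / 12 - φ ^ 2 / 2 ^ 10 := by nlinarith
  have hentropy : sqrtBracketingEntropy X (φ / 12) 𝒬 ≤ ENNReal.ofReal (16 / 100 * (√n * φ)) := by
    refine (ENNReal.mul_le_mul_iff_left (c := ENNReal.ofReal (φ / 16)) (by simpa using hφ)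
      ENNReal.ofReal_ne_top).1 ?_
    calc sqrtBracketingEntropy X (φ / 12) 𝒬 * ENNReal.ofReal (φ / 16)
        ≤ sqrtBracketingEntropy X (φ / 12) 𝒬 * ENNReal.ofReal (φ / 12 - φ ^ 2 / 2 ^ 10) := by
          gcongr
      _ ≤ ENNReal.ofReal (c * √n * φ ^ 2) :=
          (sqrtBracketingEntropy_mul_le_setLIntegral (by linarith)).trans h
      _ ≤ ENNReal.ofReal (16 / 100 * (√n * φ)) * ENNReal.ofReal (φ / 16) := by
          rw [← ENNReal.ofReal_mul (by positivity)]
          refine ENNReal.ofReal_le_ofReal ?_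
          calc c * √n * φ ^ 2 ≤ 1 / 100 * √n * φ ^ 2 := by gcongr
            _ = 16 / 100 * (√n * φ) * (φ / 16) := by ring
  obtain ⟨N, hN, hNexp⟩ := exists_hasBracketing_le_exp_sq (by positivity) hentropy
  refine ⟨N, hN, hNexp.trans (Real.exp_le_exp.2 ?_)⟩
  rw [mul_pow, mul_pow, Real.sq_sqrt n.cast_nonneg]
  nlinarith [mul_nonneg (Nat.cast_nonneg (α := ℝ) n) (sq_nonneg φ)]

end Bracketing

namespace ContaminationModel

variable {m d : ℕ} {M : ContaminationModel m d} {p φ : ℝ} {θ θ' : EuclideanSpace ℝ (Fin d)}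
  {A Om : Set (EuclideanSpace ℝ (Fin d))} {n : ℕ}

lemma hell_le_of_bracket (hp : 0 ≤ p) (hp1 : p ≤ 1) {L U : EuclideanSpace ℝ (Fin m) → ℝ}
    (hL : IntegrableOn L M.obs) (hU : IntegrableOn U M.obs) (hθ : θ ∈ M.par) (hθ' : θ' ∈ M.par)
    (h : ∀ x ∈ M.obs, L x ≤ M.f x θ ∧ M.f x θ ≤ U x)
    (h' : ∀ x ∈ M.obs, L x ≤ M.f x θ' ∧ M.f x θ' ≤ U x) :
    M.hell p θ θ' ≤ hellinger M.obs L U := by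
  refine (hell_le_hell_zero hp hp1 hθ hθ').trans ?_
  have hw : 0 ≤ hellinger M.obs L U := Real.sqrt_nonneg _
  rw [← sq_le_sq₀ (hell_nonneg _ _) hw, sq_hell, sq_hellinger]
  simp only [k_zero]
  exact hellingerSq_le_of_bracket hL hU
    ((ae_restrict_iff' M.measurableSet_obs).2 (ae_of_all _ h))
    ((ae_restrict_iff' M.measurableSet_obs).2 (ae_of_all _ h'))

lemma exists_finset_hell_le (hp : 0 ≤ p) (hp1 : p ≤ 1) (hA : A ⊆ M.par) {r : ℝ} {N : ℕ}
    (h : HasBracketing M.obs r ((fun θ x => M.f x θ) '' A) N) :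
    ∃ F : Finset (EuclideanSpace ℝ (Fin d)), ↑F ⊆ A ∧ F.card ≤ N ∧
      ∀ θ ∈ A, ∃ θ' ∈ F, M.hell p θ θ' ≤ r := by
  obtain ⟨L, U, hLU, hcover⟩ := h
  choose j hj using fun θ : A => hcover _ (mem_image_of_mem _ θ.2)
  obtain ⟨s, -, hs⟩ := exists_subset_bijOn univ j
  have hfin : (Subtype.val '' s).Finite := (Finite.of_finite_image (toFinite _) hs.injOn).image _
  refine ⟨hfin.toFinset, ?_, ?_, fun θ hθ => ?_⟩
  · simp [image_subset_iff]
  · rw [← ncard_eq_toFinset_card _ hfin, ncard_image_of_injective _ Subtype.val_injective,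
      ← hs.injOn.ncard_image]
    exact (ncard_le_card _).trans_eq (by simp)
  · obtain ⟨θ', hθ's, hθ'j⟩ := hs.surjOn (mem_image_of_mem j (mem_univ ⟨θ, hθ⟩))
    refine ⟨θ', hfin.mem_toFinset.2 (mem_image_of_mem _ hθ's), ?_⟩
    obtain ⟨hL, hU, -, -, hw⟩ := hLU (j ⟨θ, hθ⟩)
    exact (hell_le_of_bracket hp hp1 hL hU (hA hθ) (hA θ'.2) (hj ⟨θ, hθ⟩)
      (hθ'j ▸ hj θ')).trans hw

/-- Contribution of one observation to the statistic for testing the true parameter against the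
Hellinger neighbourhood of `θ`: the square root of the density ratio of the midpoint of the two
likelihoods and the true likelihood. -/
noncomputable def testRatio (M : ContaminationModel m d) (p : ℝ) (θ : EuclideanSpace ℝ (Fin d))
    (x : EuclideanSpace ℝ (Fin m)) : ℝ≥0∞ :=
  ENNReal.ofReal (√((M.kExt p x M.θstar + M.kExt p x θ) / 2) / √(M.kExt p x M.θstar))

lemma measurable_testRatio (θ : EuclideanSpace ℝ (Fin d)) : Measurable (M.testRatio p θ) :=
  ((((measurable_kExt_left _).add (measurable_kExt_left _)).div_const 2).sqrt.div
    (measurable_kExt_left _).sqrt).ennreal_ofReal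

lemma sqrt_midpoint_div_sqrt_pos (hp : 0 < p) (hp1 : p ≤ 1) (x : EuclideanSpace ℝ (Fin m))
    (θ : EuclideanSpace ℝ (Fin d)) :
    0 < √((M.kExt p x M.θstar + M.kExt p x θ) / 2) / √(M.kExt p x M.θstar) :=
  div_pos (Real.sqrt_pos.2 (half_pos (add_pos (kExt_pos hp hp1 x _) (kExt_pos hp hp1 x _))))
    (Real.sqrt_pos.2 (kExt_pos hp hp1 x _))

lemma testRatio_ne_zero (hp : 0 < p) (hp1 : p ≤ 1) (θ : EuclideanSpace ℝ (Fin d))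
    (x : EuclideanSpace ℝ (Fin m)) : M.testRatio p θ x ≠ 0 := by
  simpa [testRatio] using sqrt_midpoint_div_sqrt_pos hp hp1 x θ

lemma lintegral_testRatio_le (hp : 0 < p) (hp1 : p ≤ 1) (hφ : 0 ≤ φ) (hθ : θ ∈ M.par)
    (hfar : φ ≤ M.hell p θ M.θstar) :
    ∫⁻ x, M.testRatio p θ x ∂M.dataLaw p ≤ ENNReal.ofReal (Real.exp (-(φ ^ 2 / 16))) := by
  rw [lintegral_dataLaw (measurable_testRatio θ)]
  refine (lintegral_congr fun x => ?_).trans_le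
    ((isDensity_kExt hp.le hp1 M.θstar_mem).lintegral_sqrt_midpoint_mul_sqrt_le
      (isDensity_kExt hp.le hp1 hθ)
      (by rw [← sq_hell_eq_hellingerSq_kExt hθ M.θstar_mem]; gcongr))
  have hpos := kExt_pos (M := M) hp hp1 x M.θstar
  rw [testRatio, ← ENNReal.ofReal_mul hpos.le, mul_div_left_comm, Real.div_sqrt]

lemma lintegral_ratio_mul_inv_testRatio_le (hp : 0 < p) (hp1 : p ≤ 1) (hφ : 0 ≤ φ)
    (hθ : θ ∈ M.par) (hθ' : θ' ∈ M.par) (hfar : φ ≤ M.hell p θ' M.θstar)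
    (hnear : M.hell p θ θ' ≤ φ / 12) :
    ∫⁻ x, M.ratio p x θ * (M.testRatio p θ' x)⁻¹ ∂M.dataLaw p
      ≤ ENNReal.ofReal (Real.exp (-(φ ^ 2 / 16))) := by
  rw [lintegral_ratio_mul hp hp1 θ (h := fun x => (M.testRatio p θ' x)⁻¹)
    (measurable_testRatio θ').inv]
  refine (lintegral_congr fun x => ?_).trans_le
    ((isDensity_kExt hp.le hp1 M.θstar_mem).lintegral_mul_sqrt_div_sqrt_midpoint_le
      (isDensity_kExt hp.le hp1 hθ')
      (by rw [← sq_hell_eq_hellingerSq_kExt hθ' M.θstar_mem]; gcongr)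
      (isDensity_kExt hp.le hp1 hθ)
      (by rw [← sq_hell_eq_hellingerSq_kExt hθ hθ']; gcongr; exact hell_nonneg _ _))
  rw [testRatio, ← ENNReal.ofReal_inv_of_pos (sqrt_midpoint_div_sqrt_pos hp hp1 x θ'), inv_div,
    ← ENNReal.ofReal_mul (kExt_pos hp hp1 x θ).le]

lemma measure_le_setLIntegral_likRatio_le_of_finset (hp : 0 < p) (hp1 : p ≤ 1) (hφ : 0 ≤ φ)
    (hAm : MeasurableSet A) (hA : A ⊆ M.par) (F : Finset (EuclideanSpace ℝ (Fin d)))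
    (hF : ∀ θ' ∈ F, θ' ∈ M.par ∧ φ ≤ M.hell p θ' M.θstar)
    (hAF : ∀ θ ∈ A, ∃ θ' ∈ F, M.hell p θ θ' ≤ φ / 12) {κ : ℝ≥0∞} (hκ : κ ≠ 0) (hκ' : κ ≠ ∞) :
    (Measure.pi fun _ : Fin n => M.dataLaw p)
        {x | κ ≤ ∫⁻ θ in A, likRatio (M.ratio p) x θ ∂M.prior}
      ≤ F.card * ENNReal.ofReal (Real.exp (-(n * (φ ^ 2 / 16))))
        + ENNReal.ofReal (Real.exp (-(n * (φ ^ 2 / 16)))) / κ := by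
  have := isProbabilityMeasure_dataLaw (M := M) hp.le hp1
  have := M.isProbabilityMeasure_prior
  have hpow : ENNReal.ofReal (Real.exp (-(φ ^ 2 / 16))) ^ n
      = ENNReal.ofReal (Real.exp (-(n * (φ ^ 2 / 16)))) := by
    rw [← ENNReal.ofReal_pow (Real.exp_pos _).le, ← Real.exp_nat_mul, mul_neg]
  have htest := measure_le_setLIntegral_likRatio_le_of_tests (n := n) (M.dataLaw p) M.prior
    measurable_ratio hAm F measurable_testRatio (testRatio_ne_zero hp hp1)
    (fun θ' hθ' => lintegral_testRatio_le hp hp1 hφ (hF θ' hθ').1 (hF θ' hθ').2)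
    (fun θ hθ => (hAF θ hθ).imp fun θ' ⟨hθ', hnear⟩ =>
      ⟨hθ', lintegral_ratio_mul_inv_testRatio_le hp hp1 hφ (hA hθ) (hF θ' hθ').1
        (hF θ' hθ').2 hnear⟩) hκ hκ'
  rw [hpow] at htest
  refine htest.trans (add_le_add_right ?_ _)
  gcongr
  exact mul_le_of_le_one_right' prob_le_one

lemma measure_le_setLIntegral_likRatio_le_of_lt_hell (hp : 0 < p) (hp1 : p ≤ 1) {c : ℝ}
    (hc : c ≤ 1 / 100) (hφ : 0 < φ) (hAm : MeasurableSet A) (hAOm : A ⊆ Om) (hA : A ⊆ M.par)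
    (hfar : ∀ θ ∈ A, φ < M.hell p θ M.θstar)
    (hent : ∫⁻ u in Ioc (φ ^ 2 / 2 ^ 10) φ,
        sqrtBracketingEntropy M.obs u ((fun θ x => M.f x θ) '' Om)
      ≤ ENNReal.ofReal (c * √n * φ ^ 2)) {κ : ℝ≥0∞} (hκ : κ ≠ 0) (hκ' : κ ≠ ∞) :
    (Measure.pi fun _ : Fin n => M.dataLaw p)
        {x | κ ≤ ∫⁻ θ in A, likRatio (M.ratio p) x θ ∂M.prior}
      ≤ ENNReal.ofReal (Real.exp (-(n * (φ ^ 2 / 32))))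
        + ENNReal.ofReal (Real.exp (-(n * (φ ^ 2 / 16)))) / κ := by
  rcases A.eq_empty_or_nonempty with rfl | ⟨θ₀, hθ₀⟩
  · simp [hκ]
  have hφ1 : φ ≤ 1 :=
    (hfar θ₀ hθ₀).le.trans (hell_le_one hp.le hp1 (hA hθ₀) M.θstar_mem)
  obtain ⟨N, hN, hNexp⟩ := exists_hasBracketing_le_exp_of_setLIntegral_le hc hφ hφ1 hent
  obtain ⟨F, hFA, hFN, hAF⟩ :=
    exists_finset_hell_le hp.le hp1 hA (hN.mono le_rfl (image_mono hAOm))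
  refine (measure_le_setLIntegral_likRatio_le_of_finset hp hp1 hφ.le hAm hA F
    (fun θ' hθ' => ⟨hA (hFA hθ'), (hfar θ' (hFA hθ')).le⟩) hAF hκ hκ').trans
    (add_le_add_left ?_ _)
  rw [← ENNReal.ofReal_natCast, ← ENNReal.ofReal_mul (Nat.cast_nonneg _)]
  refine ENNReal.ofReal_le_ofReal ?_
  calc (F.card : ℝ) * Real.exp (-(n * (φ ^ 2 / 16)))
      ≤ Real.exp (n * (φ ^ 2 / 32)) * Real.exp (-(n * (φ ^ 2 / 16))) := by
        gcongr
        exact le_trans (by exact_mod_cast hFN) hNexp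
    _ = Real.exp (-(n * (φ ^ 2 / 32))) := by rw [← Real.exp_add]; ring_nf

end ContaminationModel

section DirectionalDerivatives

variable {d : ℕ} {A : Set (EuclideanSpace ℝ (Fin d))} {h : EuclideanSpace ℝ (Fin d) → ℝ}
  {θ θ₁ θ₂ u : EuclideanSpace ℝ (Fin d)} {C s : ℝ}

lemma hasDerivWithinAt_dirDeriv
    (hd : DifferentiableWithinAt ℝ (fun ξ : ℝ => h (θ + s • u + ξ • u)) (Ici 0) 0) :
    HasDerivWithinAt (fun t : ℝ => h (θ + t • u)) (dirDeriv h (θ + s • u) u) (Ici s) s := by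
  have hshift : HasDerivWithinAt (fun t : ℝ => t - s) 1 (Ici s) s :=
    ((hasDerivAt_id s).sub_const s).hasDerivWithinAt
  have hd' : HasDerivWithinAt (fun ξ : ℝ => h (θ + s • u + ξ • u)) (dirDeriv h (θ + s • u) u)
      (Ici 0) ((fun t : ℝ => t - s) s) := by
    simp only [sub_self]
    exact hd.hasDerivWithinAt
  have hcomp := hd'.comp (h := fun t : ℝ => t - s) s hshift
    fun t (ht : s ≤ t) => mem_Ici.2 (sub_nonneg.2 ht)
  rw [mul_one] at hcomp
  refine hcomp.congr_of_mem (fun t _ => ?_) self_mem_Ici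
  rw [Function.comp_apply, add_assoc, ← add_smul, add_sub_cancel]

lemma sub_le_mul_norm_sub_of_dirDeriv_le (hA : Convex ℝ A) (hh : ContinuousOn h A)
    (hdiff : ∀ θ ∈ A, ∀ u ∈ feasibleDirections A θ,
      DifferentiableWithinAt ℝ (fun ξ : ℝ => h (θ + ξ • u)) (Ici 0) 0)
    (hC : ∀ θ ∈ A, ∀ u ∈ feasibleDirections A θ, dirDeriv h θ u ≤ C)
    (h₁ : θ₁ ∈ A) (h₂ : θ₂ ∈ A) : h θ₂ - h θ₁ ≤ C * ‖θ₂ - θ₁‖ := by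
  rcases eq_or_ne θ₂ θ₁ with rfl | hne
  · simp
  have hr : 0 < ‖θ₂ - θ₁‖ := norm_pos_iff.2 (sub_ne_zero.2 hne)
  generalize hr' : ‖θ₂ - θ₁‖ = r at hr ⊢
  let u := r⁻¹ • (θ₂ - θ₁)
  have hu : ‖u‖ = 1 := by
    rw [norm_smul, hr', norm_inv, Real.norm_of_nonneg hr.le, inv_mul_cancel₀ hr.ne']
  have hend : θ₁ + r • u = θ₂ := by rw [smul_inv_smul₀ hr.ne', add_sub_cancel]
  have hseg : ∀ s ∈ Icc 0 r, θ₁ + s • u ∈ A := fun s hs => by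
    rw [smul_smul]
    exact hA.add_smul_sub_mem h₁ h₂
      ⟨mul_nonneg hs.1 (inv_nonneg.2 hr.le), by rw [← div_eq_mul_inv, div_le_one hr]; exact hs.2⟩
  have hfeas : ∀ s ∈ Ico 0 r, u ∈ feasibleDirections A (θ₁ + s • u) := fun s hs => by
    refine ⟨hu, r - s, sub_pos.2 hs.2, ?_⟩
    rwa [add_assoc, ← add_smul, add_sub_cancel, hend]
  have hcont : ContinuousOn (fun s : ℝ => h (θ₁ + s • u)) (Icc 0 r) :=
    hh.comp (Continuous.continuousOn (by fun_prop)) hseg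
  have hline : ∀ s, HasDerivAt (fun s : ℝ => h θ₁ + C * s) C s := fun s => by
    simpa using ((hasDerivAt_id s).const_mul C).const_add (h θ₁)
  have hmain := image_le_of_deriv_right_le_deriv_boundary hcont
    (fun s hs => hasDerivWithinAt_dirDeriv
      (hdiff _ (hseg s (Ico_subset_Icc_self hs)) u (hfeas s hs)))
    (B := fun s => h θ₁ + C * s) (by simp) (fun s _ => (hline s).continuousAt.continuousWithinAt)
    (fun s _ => (hline s).hasDerivWithinAt)
    (fun s hs => hC _ (hseg s (Ico_subset_Icc_self hs)) u (hfeas s hs)) (right_mem_Icc.2 hr.le)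
  simp only [hend] at hmain
  linarith

end DirectionalDerivatives

section PosteriorComparison

variable {E Θ : Type*} {n : ℕ}

lemma Neighbouring.symm {x z : Fin n → E} (h : Neighbouring x z) : Neighbouring z x :=
  h.imp fun _ hi j hj => (hi j hj).symm

lemma Neighbouring.likRatio_le {r : E → Θ → ℝ≥0∞} {x z : Fin n → E} (h : Neighbouring x z)
    {c : ℝ≥0∞} {θ : Θ} (hx : ∀ j, r (x j) θ ≤ c) (hz : ∀ j, 1 ≤ c * r (z j) θ) :
    likRatio r x θ ≤ c * c * likRatio r z θ := by
  obtain ⟨i, hi⟩ := h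
  have hrest : ∏ j ∈ Finset.univ.erase i, r (x j) θ = ∏ j ∈ Finset.univ.erase i, r (z j) θ :=
    Finset.prod_congr rfl fun j hj => by rw [hi j (Finset.ne_of_mem_erase hj)]
  have hdiffering : r (x i) θ ≤ c * c * r (z i) θ :=
    calc r (x i) θ ≤ c * 1 := by rw [mul_one]; exact hx i
      _ ≤ c * (c * r (z i) θ) := by gcongr; exact hz i
      _ = c * c * r (z i) θ := (mul_assoc _ _ _).symm
  rw [likRatio, likRatio, ← Finset.mul_prod_erase _ _ (Finset.mem_univ i),
    ← Finset.mul_prod_erase _ (fun j => r (z j) θ) (Finset.mem_univ i), hrest, ← mul_assoc]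
  gcongr

variable [MeasurableSpace Θ] {π : Measure Θ} {G H : Θ → ℝ≥0∞} {A S U V : Set Θ}
  {c δ l κ : ℝ≥0∞}

lemma setLIntegral_le_mul_add (hS : MeasurableSet S) (hU : MeasurableSet U) (hSA : S ⊆ A)
    (hc : c ≠ ∞) (hG : ∀ θ ∈ A, θ ∉ U → G θ ≤ c * H θ) (hGU : ∫⁻ θ in A ∩ U, G θ ∂π ≤ κ) :
    ∫⁻ θ in S, G θ ∂π ≤ c * (∫⁻ θ in S, H θ ∂π) + κ := by
  rw [← lintegral_inter_add_sdiff G S hU, add_comm]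
  refine add_le_add ?_ ((lintegral_mono_set (inter_subset_inter_left _ hSA)).trans hGU)
  calc ∫⁻ θ in S \ U, G θ ∂π ≤ ∫⁻ θ in S \ U, c * H θ ∂π :=
        setLIntegral_mono' (hS.diff hU) fun θ hθ => hG θ (hSA hθ.1) hθ.2
    _ ≤ ∫⁻ θ in S, c * H θ ∂π := lintegral_mono_set sdiff_subset
    _ = c * ∫⁻ θ in S, H θ ∂π := lintegral_const_mul' _ _ hc

lemma setLIntegral_div_le (hA : MeasurableSet A) (hS : MeasurableSet S) (hU : MeasurableSet U)
    (hV : MeasurableSet V) (hSA : S ⊆ A) (hc0 : c ≠ 0) (hc : c ≠ ∞) (hδ : δ ≠ ∞) (hl : l ≠ 0)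
    (hG : ∀ θ ∈ A, θ ∉ U → G θ ≤ c * H θ) (hH : ∀ θ ∈ A, θ ∉ V → H θ ≤ c * G θ)
    (hGU : ∫⁻ θ in A ∩ U, G θ ∂π ≤ κ) (hHV : ∫⁻ θ in A ∩ V, H θ ∂π ≤ κ)
    (hlG : l ≤ ∫⁻ θ in A, G θ ∂π) (hκ : κ ≤ δ * l) :
    (∫⁻ θ in S, G θ ∂π) / (∫⁻ θ in A, G θ ∂π)
      ≤ c * (δ + c) * ((∫⁻ θ in S, H θ ∂π) / ∫⁻ θ in A, H θ ∂π) + δ := by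
  have hGS := setLIntegral_le_mul_add hS hU hSA hc hG hGU
  have hHA := setLIntegral_le_mul_add hA hV Subset.rfl hc hH hHV
  generalize ∫⁻ θ in A, G θ ∂π = IG, ∫⁻ θ in A, H θ ∂π = IH, ∫⁻ θ in S, G θ ∂π = JG,
    ∫⁻ θ in S, H θ ∂π = JH at *
  have hκG : κ ≤ δ * IG := hκ.trans (by gcongr)
  have hIG0 : IG ≠ 0 := ((pos_iff_ne_zero.2 hl).trans_le hlG).ne'
  rcases eq_or_ne IG ∞ with rfl | hIG
  · simp
  have hsum0 : δ + c ≠ 0 := by simp [hc0]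
  have hsum : δ + c ≠ ∞ := ENNReal.add_ne_top.2 ⟨hδ, hc⟩
  have hIHG : IH ≤ (δ + c) * IG :=
    calc IH ≤ c * IG + δ * IG := hHA.trans (by gcongr)
      _ = (δ + c) * IG := by ring
  have hinv : IG⁻¹ ≤ (δ + c) * IH⁻¹ :=
    calc IG⁻¹ = (δ + c) * ((δ + c) * IG)⁻¹ := by
          rw [ENNReal.mul_inv (Or.inl hsum0) (Or.inl hsum), ← mul_assoc,
            ENNReal.mul_inv_cancel hsum0 hsum, one_mul]
      _ ≤ (δ + c) * IH⁻¹ := by gcongr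
  calc JG / IG ≤ (c * JH + δ * IG) / IG := by gcongr; exact hGS.trans (by gcongr)
    _ = c * JH * IG⁻¹ + δ := by
        rw [ENNReal.add_div, mul_div_assoc δ, ENNReal.div_self hIG0 hIG, mul_one, div_eq_mul_inv]
    _ ≤ c * JH * ((δ + c) * IH⁻¹) + δ := by gcongr
    _ = c * (δ + c) * (JH / IH) + δ := by rw [div_eq_mul_inv]; ring

end PosteriorComparison

namespace ContaminationModel

variable {m d n : ℕ} {M : ContaminationModel m d} {p c ε δ ψ τ : ℝ}
  {y : EuclideanSpace ℝ (Fin m)} {x z : Fin n → EuclideanSpace ℝ (Fin m)}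
  {θ θ₁ θ₂ : EuclideanSpace ℝ (Fin d)} {S U V : Set (EuclideanSpace ℝ (Fin d))}

/-- The regularity half of `TailAssumption`: the one-sided directional derivatives of the
likelihood exist and are bounded at each point, so that `supDirDeriv` is a true supremum. -/
def HasBoundedDirDeriv (M : ContaminationModel m d) : Prop :=
  ∀ x ∈ M.obs, ∀ θ ∈ M.par,
    (∀ u ∈ feasibleDirections M.par θ,
      DifferentiableWithinAt ℝ (fun ξ : ℝ => M.f x (θ + ξ • u)) (Ici 0) 0) ∧
    ∃ B : ℝ, ∀ u ∈ feasibleDirections M.par θ, |dirDeriv (M.f x) θ u| ≤ B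

lemma f_sub_f_le (hM : M.HasBoundedDirDeriv) (hτ : M.DerivRatioBound ψ τ) (h₁ : θ₁ ∈ M.par)
    (h₂ : θ₂ ∈ M.par) (h₁ψ : ‖θ₁ - M.θstar‖ ≤ ψ) (h₂ψ : ‖θ₂ - M.θstar‖ ≤ ψ) (hy : y ∈ M.obs) :
    M.f y θ₂ - M.f y θ₁ ≤ τ * M.g y * ‖θ₂ - θ₁‖ := by
  have hcont : ContinuousOn (M.f y) M.par :=
    M.continuousOn_f.comp (f := fun θ => (y, θ)) (Continuous.continuousOn (by fun_prop))
      fun _ hθ => ⟨hy, hθ⟩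
  have hfeas : ∀ θ, feasibleDirections (M.par ∩ Metric.closedBall M.θstar ψ) θ
      ⊆ feasibleDirections M.par θ := fun θ u hu =>
    ⟨hu.1, hu.2.imp fun _ hξ => ⟨hξ.1, hξ.2.1⟩⟩
  refine sub_le_mul_norm_sub_of_dirDeriv_le
    (M.convex_par.inter (convex_closedBall M.θstar ψ)) (hcont.mono inter_subset_left)
    (fun θ hθ u hu => (hM y hy θ hθ.1).1 u (hfeas θ hu)) (fun θ hθ u hu => ?_)
    ⟨h₁, mem_closedBall_iff_norm.2 h₁ψ⟩ ⟨h₂, mem_closedBall_iff_norm.2 h₂ψ⟩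
  obtain ⟨B, hB⟩ := (hM y hy θ hθ.1).2
  calc dirDeriv (M.f y) θ u ≤ M.supDirDeriv y θ :=
        le_csSup ⟨B, by rintro _ ⟨v, hv, rfl⟩; exact (le_abs_self _).trans (hB v hv)⟩
          (mem_image_of_mem _ (hfeas θ hu))
    _ ≤ τ * M.g y := (div_le_iff₀ (M.g_pos y hy)).1
        ((le_abs_self _).trans (hτ θ hθ.1 (mem_closedBall_iff_norm.1 hθ.2) y hy))

lemma mul_g_le_k (hp1 : p ≤ 1) (hy : y ∈ M.obs) (hθ : θ ∈ M.par) : p * M.g y ≤ M.k p y θ :=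
  le_add_of_nonneg_left (mul_nonneg (sub_nonneg.2 hp1) (M.f_nonneg y hy θ hθ))

lemma k_le_exp_mul (hp : 0 < p) (hp1 : p ≤ 1) (hM : M.HasBoundedDirDeriv)
    (hτ : M.DerivRatioBound ψ τ) (h₁ : θ₁ ∈ M.par) (h₂ : θ₂ ∈ M.par)
    (h₁ψ : ‖θ₁ - M.θstar‖ ≤ ψ) (h₂ψ : ‖θ₂ - M.θstar‖ ≤ ψ) (h₁₂ : ‖θ₂ - θ₁‖ ≤ ψ)
    (hy : y ∈ M.obs) : M.k p y θ₂ ≤ Real.exp (epsTilde p τ ψ / 2) * M.k p y θ₁ := by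
  have hg := M.g_pos y hy
  have : 0 ≤ 1 - p := sub_nonneg.2 hp1
  have hτ0 : 0 ≤ τ := (abs_nonneg _).trans (hτ θ₁ h₁ h₁ψ y hy)
  have hψ : 0 ≤ ψ := (norm_nonneg _).trans h₁ψ
  have hη : epsTilde p τ ψ / 2 * (p * M.g y) = (1 - p) * (τ * M.g y * ψ) := by
    unfold epsTilde
    field_simp
  have hη0 : 0 ≤ epsTilde p τ ψ / 2 := by
    unfold epsTilde
    positivity
  have hf : M.f y θ₂ - M.f y θ₁ ≤ τ * M.g y * ψ :=
    (f_sub_f_le hM hτ h₁ h₂ h₁ψ h₂ψ hy).trans (by gcongr)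
  calc M.k p y θ₂ = M.k p y θ₁ + (1 - p) * (M.f y θ₂ - M.f y θ₁) := by unfold k; ring
    _ ≤ M.k p y θ₁ + epsTilde p τ ψ / 2 * (p * M.g y) := by rw [hη]; gcongr
    _ ≤ M.k p y θ₁ + epsTilde p τ ψ / 2 * M.k p y θ₁ := by
        gcongr
        exact mul_g_le_k hp1 hy h₁
    _ = (epsTilde p τ ψ / 2 + 1) * M.k p y θ₁ := by ring
    _ ≤ Real.exp (epsTilde p τ ψ / 2) * M.k p y θ₁ := by
        gcongr
        · exact (k_pos hp hp1 hy h₁).le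
        · exact Real.add_one_le_exp _

lemma ratio_le_ofReal (hp : 0 < p) (hp1 : p ≤ 1) (hy : y ∈ M.obs) (hθ : θ ∈ M.par) (hc : 0 ≤ c)
    (h : M.k p y θ ≤ c * M.k p y M.θstar) : M.ratio p y θ ≤ ENNReal.ofReal c := by
  rw [ratio, ENNReal.div_le_iff (ofReal_kExt_ne_zero hp hp1 _ _) ENNReal.ofReal_ne_top,
    ← ENNReal.ofReal_mul hc, kExt_of_mem hy hθ, kExt_of_mem hy M.θstar_mem]
  exact ENNReal.ofReal_le_ofReal h

lemma one_le_ofReal_mul_ratio (hp : 0 < p) (hp1 : p ≤ 1) (hy : y ∈ M.obs) (hθ : θ ∈ M.par)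
    (hc : 0 ≤ c) (h : M.k p y M.θstar ≤ c * M.k p y θ) :
    1 ≤ ENNReal.ofReal c * M.ratio p y θ := by
  rw [ratio, ← mul_div_assoc, ENNReal.le_div_iff_mul_le
    (Or.inl (ofReal_kExt_ne_zero hp hp1 _ _)) (Or.inl ENNReal.ofReal_ne_top), one_mul,
    ← ENNReal.ofReal_mul hc, kExt_of_mem hy hθ, kExt_of_mem hy M.θstar_mem]
  exact ENNReal.ofReal_le_ofReal h

lemma posterior_eq (hp : 0 < p) (hp1 : p ≤ 1) (hx : ∀ j, x j ∈ M.obs) (hS : MeasurableSet S)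
    (hSp : S ⊆ M.par) : M.posterior p x S = (∫⁻ θ in S, likRatio (M.ratio p) x θ ∂M.prior) /
      ∫⁻ θ in M.par, likRatio (M.ratio p) x θ ∂M.prior := by
  let L : ℝ≥0∞ := ∏ j, ENNReal.ofReal (M.kExt p (x j) M.θstar)
  have hL0 : L ≠ 0 := Finset.prod_ne_zero_iff.2 fun j _ => ofReal_kExt_ne_zero hp hp1 _ _
  have hL : L ≠ ∞ := ENNReal.prod_ne_top fun j _ => ENNReal.ofReal_ne_top
  have hscale : ∀ {B : Set (EuclideanSpace ℝ (Fin d))}, MeasurableSet B → B ⊆ M.par →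
      ∫⁻ θ in B, ∏ i, ENNReal.ofReal (M.k p (x i) θ) ∂M.prior
        = L * ∫⁻ θ in B, likRatio (M.ratio p) x θ ∂M.prior := fun hB hBp => by
    rw [← lintegral_const_mul' _ _ hL]
    refine setLIntegral_congr_fun hB fun θ hθ => ?_
    simp only [L, likRatio]
    rw [← Finset.prod_mul_distrib]
    refine Finset.prod_congr rfl fun j _ => ?_
    rw [ratio, ENNReal.mul_div_cancel (ofReal_kExt_ne_zero hp hp1 _ _) ENNReal.ofReal_ne_top,
      kExt_of_mem (hx j) (hBp hθ)]
  rw [posterior, hscale hS hSp, hscale M.measurableSet_par subset_rfl,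
    ENNReal.mul_div_mul_left _ _ hL0 hL]

lemma posterior_le (hp : 0 < p) (hp1 : p ≤ 1) (hx : ∀ j, x j ∈ M.obs) (hz : ∀ j, z j ∈ M.obs)
    (hU : MeasurableSet U) (hV : MeasurableSet V) (hδ : 0 < δ) {l κ : ℝ≥0∞} (hl : l ≠ 0)
    (hxU : ∀ θ ∈ M.par, θ ∉ U →
      likRatio (M.ratio p) x θ ≤ ENNReal.ofReal (Real.exp ε) * likRatio (M.ratio p) z θ)
    (hzV : ∀ θ ∈ M.par, θ ∉ V →
      likRatio (M.ratio p) z θ ≤ ENNReal.ofReal (Real.exp ε) * likRatio (M.ratio p) x θ)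
    (hκx : ∫⁻ θ in M.par ∩ U, likRatio (M.ratio p) x θ ∂M.prior ≤ κ)
    (hκz : ∫⁻ θ in M.par ∩ V, likRatio (M.ratio p) z θ ∂M.prior ≤ κ)
    (hlx : l ≤ ∫⁻ θ in M.par, likRatio (M.ratio p) x θ ∂M.prior)
    (hκl : κ ≤ ENNReal.ofReal δ * l) (hS : MeasurableSet S) (hSp : S ⊆ M.par) :
    M.posterior p x S ≤ ENNReal.ofReal (Real.exp (ε + Real.log (δ + Real.exp ε)))
      * M.posterior p z S + ENNReal.ofReal δ := by
  rw [posterior_eq hp hp1 hx hS hSp, posterior_eq hp hp1 hz hS hSp, Real.exp_add,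
    Real.exp_log (by positivity), ENNReal.ofReal_mul (Real.exp_pos _).le,
    ENNReal.ofReal_add hδ.le (Real.exp_pos _).le]
  exact setLIntegral_div_le M.measurableSet_par hS hU hV hSp (by simp [Real.exp_pos])
    ENNReal.ofReal_ne_top ENNReal.ofReal_ne_top hl hxU hzV hκx hκz hlx hκl

lemma ae_forall_mem_obs (hp : 0 ≤ p) (hp1 : p ≤ 1) :
    ∀ᵐ x ∂(Measure.pi fun _ : Fin n => M.dataLaw p), ∀ j, x j ∈ M.obs := by
  have := isProbabilityMeasure_dataLaw (M := M) hp hp1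
  have hobs : ∀ᵐ y ∂M.dataLaw p, y ∈ M.obs :=
    (withDensity_absolutelyContinuous _ _).ae_le (ae_restrict_mem M.measurableSet_obs)
  exact eventually_all.2 fun j =>
    (Measure.tendsto_eval_ae_ae (μ := fun _ : Fin n => M.dataLaw p) (i := j)).eventually hobs

/-- The factor `2` is a union bound over the two datasets, which need not be independent. -/
lemma IsNeighbourLaw.measure_le_two_mul
    {P : Measure ((Fin n → EuclideanSpace ℝ (Fin m)) × (Fin n → EuclideanSpace ℝ (Fin m)))}
    (hP : M.IsNeighbourLaw p n P) (hp : 0 ≤ p) (hp1 : p ≤ 1)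
    {bad : Set (Fin n → EuclideanSpace ℝ (Fin m))} {b : ℝ≥0∞}
    (hbad : (Measure.pi fun _ : Fin n => M.dataLaw p) bad ≤ b)
    {s : Set ((Fin n → EuclideanSpace ℝ (Fin m)) × (Fin n → EuclideanSpace ℝ (Fin m)))}
    (hs : ∀ x z, x ∉ bad → z ∉ bad → (∀ j, x j ∈ M.obs) → (∀ j, z j ∈ M.obs) →
      Neighbouring x z → (x, z) ∉ s) : P s ≤ 2 * b := by
  obtain ⟨hfst, hsnd, hneighbouring⟩ := hP
  have hobs₁ : ∀ᵐ w ∂P, ∀ j, w.1 j ∈ M.obs :=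
    ae_of_ae_map measurable_fst.aemeasurable (hfst ▸ ae_forall_mem_obs hp hp1)
  have hobs₂ : ∀ᵐ w ∂P, ∀ j, w.2 j ∈ M.obs :=
    ae_of_ae_map measurable_snd.aemeasurable (hsnd ▸ ae_forall_mem_obs hp hp1)
  calc P s ≤ P (Prod.fst ⁻¹' bad ∪ Prod.snd ⁻¹' bad) := by
        refine measure_mono_ae ?_
        filter_upwards [hneighbouring, hobs₁, hobs₂] with w hw h₁ h₂ hws
        by_contra hgood
        exact hs w.1 w.2 (fun h => hgood (Or.inl h)) (fun h => hgood (Or.inr h)) h₁ h₂ hw hws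
    _ ≤ b + b := (measure_union_le _ _).trans (add_le_add
        ((Measure.le_map_apply measurable_fst.aemeasurable _).trans (hfst ▸ hbad))
        ((Measure.le_map_apply measurable_snd.aemeasurable _).trans (hsnd ▸ hbad)))
    _ = 2 * b := (two_mul b).symm

lemma measure_privacyFailure_le_of_ratio_le
    {P : Measure ((Fin n → EuclideanSpace ℝ (Fin m)) × (Fin n → EuclideanSpace ℝ (Fin m)))}
    (hP : M.IsNeighbourLaw p n P) (hp : 0 < p) (hp1 : p ≤ 1) (hδ : 0 < δ) {l κ : ℝ≥0∞}
    (hl : l ≠ 0) (hκl : κ ≤ ENNReal.ofReal δ * l)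
    {U : (Fin n → EuclideanSpace ℝ (Fin m)) → Set (EuclideanSpace ℝ (Fin d))}
    (hU : ∀ x, MeasurableSet (U x)) {bad : Set (Fin n → EuclideanSpace ℝ (Fin m))}
    (hratio : ∀ x z, x ∉ bad → z ∉ bad → (∀ j, x j ∈ M.obs) → (∀ j, z j ∈ M.obs) →
      ∀ θ ∈ M.par, θ ∉ U x → ∀ j, M.ratio p (x j) θ ≤ ENNReal.ofReal (Real.exp (ε / 2)) ∧
        1 ≤ ENNReal.ofReal (Real.exp (ε / 2)) * M.ratio p (z j) θ)
    {b₀ b₁ b₂ : ℝ≥0∞} (hb₀ : (Measure.pi fun _ : Fin n => M.dataLaw p) bad ≤ b₀)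
    (hb₁ : (Measure.pi fun _ : Fin n => M.dataLaw p)
      {x | ∫⁻ θ in M.par, likRatio (M.ratio p) x θ ∂M.prior < l} ≤ b₁)
    (hb₂ : (Measure.pi fun _ : Fin n => M.dataLaw p)
      {x | κ ≤ ∫⁻ θ in M.par ∩ U x, likRatio (M.ratio p) x θ ∂M.prior} ≤ b₂) :
    P (M.privacyFailure p n (ε + Real.log (δ + Real.exp ε)) δ) ≤ 2 * (b₀ + b₁ + b₂) := by
  have hc : ENNReal.ofReal (Real.exp (ε / 2)) * ENNReal.ofReal (Real.exp (ε / 2))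
      = ENNReal.ofReal (Real.exp ε) := by
    rw [← ENNReal.ofReal_mul (Real.exp_pos _).le, ← Real.exp_add, add_halves]
  have hbad := (measure_union_le _ _).trans
    (add_le_add ((measure_union_le _ _).trans (add_le_add hb₀ hb₁)) hb₂)
  refine hP.measure_le_two_mul hp.le hp1 hbad fun x z hx hz hxo hzo hxz => ?_
  have hlik : ∀ x z, x ∉ bad → z ∉ bad → (∀ j, x j ∈ M.obs) → (∀ j, z j ∈ M.obs) →
      Neighbouring x z → ∀ θ ∈ M.par, θ ∉ U x →
      likRatio (M.ratio p) x θ ≤ ENNReal.ofReal (Real.exp ε) * likRatio (M.ratio p) z θ :=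
    fun x z hx hz hxo hzo hxz θ hθ hθU => by
      have h := hratio x z hx hz hxo hzo θ hθ hθU
      exact hc ▸ hxz.likRatio_le (fun j => (h j).1) fun j => (h j).2
  simp only [mem_union, not_or, mem_ofPred_eq, not_lt, not_le] at hx hz
  obtain ⟨⟨hx₀, hx₁⟩, hx₂⟩ := hx
  obtain ⟨⟨hz₀, -⟩, hz₂⟩ := hz
  exact not_not.2 fun S hS hSp => posterior_le hp hp1 hxo hzo (hU x) (hU z) hδ hl
    (hlik x z hx₀ hz₀ hxo hzo hxz) (hlik z x hz₀ hx₀ hzo hxo hxz.symm)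
    hx₂.le hz₂.le hx₁ hκl hS hSp

end ContaminationModel

section Rates

variable {c₁ c₂ c₃ r s φ α C C₁ C₂ C₃ : ℝ} {n : ℕ}

lemma deltaLevel_pos (hc₃ : 0 < c₃) : 0 < deltaLevel c₁ c₃ n φ := by
  unfold deltaLevel
  positivity

lemma ofReal_deltaLevel_mul (hc₃ : 0 < c₃) :
    ENNReal.ofReal (deltaLevel c₁ c₃ n φ)
        * ENNReal.ofReal (c₃ / 2 * Real.exp (-(4 * n * (c₁ * φ ^ 2 / 8))))
      = 2 * ENNReal.ofReal (Real.exp (-(n * (c₁ * φ ^ 2)))) := by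
  have hexp : Real.exp (-(n * (c₁ * φ ^ 2))) = Real.exp (-(1 / 2 * c₁ * n * φ ^ 2))
      * Real.exp (-(4 * n * (c₁ * φ ^ 2 / 8))) := by
    rw [← Real.exp_add]
    ring_nf
  have htwo : (2 : ℝ≥0∞) = ENNReal.ofReal 2 := by simp
  rw [htwo, ← ENNReal.ofReal_mul (deltaLevel_pos hc₃).le, ← ENNReal.ofReal_mul two_pos.le, hexp,
    deltaLevel]
  congr 1
  field_simp
  norm_num

lemma exp_neg_mul_sq_le (h : r ≤ s) :
    Real.exp (-(n * (s * φ ^ 2))) ≤ Real.exp (-(n * r * φ ^ 2)) := by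
  rw [mul_assoc (n : ℝ)]
  gcongr

lemma le_failureBound : C * Real.exp (-(n * min (c₁ * α / 8) c₂ * φ ^ 2))
    ≤ failureBound c₁ c₂ α C C 1 n φ := by
  unfold failureBound
  split_ifs
  · exact le_rfl
  · gcongr
    exact le_add_of_nonneg_right (by positivity)

lemma tendsto_failureBound (hc₁ : 0 < c₁) (hc₂ : 0 < c₂) (hα : 0 < α) {φ : ℕ → ℝ}
    (hφ : Tendsto (fun n : ℕ => (n : ℝ) * φ n ^ 2) atTop atTop) :
    Tendsto (fun n => failureBound c₁ c₂ α C₁ C₂ C₃ n (φ n)) atTop (𝓝 0) := by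
  have hc : 0 < min (c₁ * α / 8) c₂ := lt_min (by positivity) hc₂
  have hexp : Tendsto (fun n : ℕ => C₁ * Real.exp (-(min (c₁ * α / 8) c₂ * (n * φ n ^ 2)))) atTop
      (𝓝 0) := by
    simpa using (Real.tendsto_exp_neg_atTop_nhds_zero.comp (hφ.const_mul_atTop hc)).const_mul C₁
  refine hexp.congr' ?_
  filter_upwards [(hφ.const_mul_atTop hc₂).eventually_ge_atTop (Real.log 2)] with n hn
  rw [failureBound, if_pos (by linarith)]
  ring_nf

end Rates

section MeasureBounds

lemma measure_pi_exists_mem_le {ι E : Type*} [Fintype ι] [MeasurableSpace E] (P : Measure E)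
    [IsProbabilityMeasure P] {s : Set E} (hs : MeasurableSet s) :
    (Measure.pi fun _ : ι => P) {x | ∃ j, x j ∈ s} ≤ Fintype.card ι * P s := by
  rw [ofPred_exists]
  calc (Measure.pi fun _ : ι => P) (⋃ j, {x | x j ∈ s})
      ≤ ∑ j, (Measure.pi fun _ : ι => P) {x | x j ∈ s} := measure_iUnion_fintype_le _ _
    _ = ∑ _j : ι, P s := Finset.sum_congr rfl fun j _ =>
        (measurePreserving_eval (fun _ : ι => P) j).measure_preimage hs.nullMeasurableSet
    _ = Fintype.card ι * P s := by simp

lemma tendsto_measure_lt_natCast_atTop {E : Type*} [MeasurableSpace E] (ν : Measure E)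
    [IsFiniteMeasure ν] {R : E → ℝ} (hR : Measurable R) :
    Tendsto (fun V : ℕ => ν {z | (V : ℝ) < R z}) atTop (𝓝 0) := by
  have hempty : ⋂ V : ℕ, {z | (V : ℝ) < R z} = ∅ := by
    refine eq_empty_of_forall_notMem fun z hz => ?_
    obtain ⟨V, hV⟩ := exists_nat_ge (R z)
    exact (mem_iInter.1 hz V).not_ge hV
  rw [← measure_empty (μ := ν), ← hempty]
  exact tendsto_measure_iInter_atTop
    (fun V => (measurableSet_lt measurable_const hR).nullMeasurableSet)
    (fun V W hVW z (hz : (W : ℝ) < R z) => (Nat.cast_le.2 hVW).trans_lt hz)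
    ⟨0, measure_ne_top _ _⟩

end MeasureBounds

namespace ContaminationModel

section Exceedance

variable {m d : ℕ} {M : ContaminationModel m d} {p V T ψ : ℝ} {η : ℝ≥0∞}
  {y : EuclideanSpace ℝ (Fin m)} {θ θ' : EuclideanSpace ℝ (Fin d)}

/-- The set where `f / g` exceeds `V`. It is measurable, being written with `kExt`, which on the
model is `f` at `p = 0` and `g` at `p = 1`. -/
def exceedanceSet (M : ContaminationModel m d) (V : ℝ) :
    Set (EuclideanSpace ℝ (Fin m) × EuclideanSpace ℝ (Fin d)) :=
  {z | V < M.kExt 0 z.1 z.2 / M.kExt 1 z.1 z.2}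

lemma measurableSet_exceedanceSet : MeasurableSet (M.exceedanceSet V) :=
  measurableSet_lt measurable_const (measurable_kExt.div measurable_kExt)

lemma f_le_of_notMem_exceedanceSet (hy : y ∈ M.obs) (hθ : θ ∈ M.par)
    (h : (y, θ) ∉ M.exceedanceSet V) : M.f y θ ≤ V * M.g y := by
  rw [exceedanceSet, mem_ofPred_eq, not_lt, kExt_of_mem hy hθ, kExt_of_mem hy hθ] at h
  simpa [k, div_le_iff₀ (M.g_pos y hy)] using h

lemma k_le_exp_mul_of_notMem_exceedanceSet (hp : 0 < p) (hp1 : p ≤ 1) (hV : 0 ≤ V)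
    (hT : V + 1 ≤ (1 - p) * T * ψ) (hy : y ∈ M.obs) (hθ : θ ∈ M.par) (hθ' : θ' ∈ M.par)
    (h : (y, θ) ∉ M.exceedanceSet V) :
    M.k p y θ ≤ Real.exp (epsTilde p T ψ / 2) * M.k p y θ' := by
  have hg := M.g_pos y hy
  have hf := f_le_of_notMem_exceedanceSet hy hθ h
  have hexp : (V + 1) / p ≤ Real.exp (epsTilde p T ψ / 2) :=
    calc (V + 1) / p ≤ (1 - p) * T * ψ / p := by gcongr
      _ = epsTilde p T ψ / 2 := by unfold epsTilde; ring
      _ ≤ Real.exp (epsTilde p T ψ / 2) := by linarith [Real.add_one_le_exp (epsTilde p T ψ / 2)]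
  calc M.k p y θ ≤ (1 - p) * (V * M.g y) + p * M.g y := by
        unfold k
        have := sub_nonneg.2 hp1
        gcongr
    _ ≤ 1 * (V * M.g y) + 1 * M.g y := by gcongr; linarith
    _ = (V + 1) / p * (p * M.g y) := by field_simp
    _ ≤ Real.exp (epsTilde p T ψ / 2) * M.k p y θ' := by
        gcongr
        exact mul_g_le_k hp1 hy hθ'

lemma ofReal_kExt_le_add (hp : 0 ≤ p) (hp1 : p ≤ 1) (y : EuclideanSpace ℝ (Fin m))
    (θ : EuclideanSpace ℝ (Fin d)) : ENNReal.ofReal (M.kExt p y θ)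
      ≤ ENNReal.ofReal (M.kExt 0 y θ) + ENNReal.ofReal (M.kExt 1 y θ) := by
  classical
  refine le_trans (ENNReal.ofReal_le_ofReal ?_) ENNReal.ofReal_add_le
  by_cases h : (y, θ) ∈ M.obs ×ˢ M.par
  · have hf := M.f_nonneg y h.1 θ h.2
    have hg := M.g_pos y h.1
    simp only [kExt_of_mem h.1 h.2, k]
    nlinarith
  · simp only [kExt, piecewise_eq_of_notMem _ _ _ h, Pi.one_apply]
    norm_num

/-- Uniformity in `p` holds because all the densities `k_p` lie below `f + g`. -/
lemma eventually_forall_setLIntegral_exceedanceSet_le (hη : η ≠ 0)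
    (π : Measure (EuclideanSpace ℝ (Fin d))) [IsFiniteMeasure π] :
    ∀ᶠ V : ℕ in atTop, ∀ p : ℝ, 0 ≤ p → p ≤ 1 → ∫⁻ θ in M.par, (∫⁻ y in M.obs,
      ENNReal.ofReal (M.kExt p y θ) * (M.exceedanceSet V).indicator 1 (y, θ)) ∂π ≤ η := by
  let D : EuclideanSpace ℝ (Fin m) × EuclideanSpace ℝ (Fin d) → ℝ≥0∞ := fun z =>
    ENNReal.ofReal (M.kExt 0 z.1 z.2) + ENNReal.ofReal (M.kExt 1 z.1 z.2)
  have hD : Measurable D := measurable_kExt.ennreal_ofReal.add measurable_kExt.ennreal_ofReal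
  let ν := ((volume.restrict M.obs).prod (π.restrict M.par)).withDensity D
  have hDθ : ∀ θ ∈ M.par, ∫⁻ y in M.obs, D (y, θ) = 2 := fun θ hθ => by
    rw [lintegral_add_left (measurable_kExt_left θ).ennreal_ofReal,
      (isDensity_kExt le_rfl zero_le_one hθ).lintegral_eq_one,
      (isDensity_kExt zero_le_one le_rfl hθ).lintegral_eq_one, one_add_one_eq_two]
  have : IsFiniteMeasure ν := isFiniteMeasure_withDensity <| by
    rw [lintegral_prod_symm _ hD.aemeasurable, setLIntegral_congr_fun M.measurableSet_par hDθ]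
    simp [ENNReal.mul_eq_top]
  filter_upwards [(tendsto_measure_lt_natCast_atTop ν (measurable_kExt.div
    measurable_kExt : Measurable fun z => M.kExt 0 z.1 z.2 / M.kExt 1 z.1 z.2)).eventually_le_const
    (pos_iff_ne_zero.2 hη)] with V hV p hp hp1
  refine le_trans ?_ hV
  have hS : MeasurableSet (M.exceedanceSet V) := measurableSet_exceedanceSet
  change _ ≤ ν (M.exceedanceSet V)
  rw [withDensity_apply _ hS, ← lintegral_indicator hS,
    lintegral_prod_symm _ (hD.indicator hS).aemeasurable]
  refine lintegral_mono fun θ => lintegral_mono fun y => ?_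
  by_cases h : (y, θ) ∈ M.exceedanceSet V
  · simpa [h] using ofReal_kExt_le_add hp hp1 y θ
  · simp [h]

lemma exists_exceedanceSet_threshold (M : ContaminationModel m d) (hη : η ≠ 0) :
    ∃ V : ℕ, ∀ p : ℝ, 0 < p → p ≤ 1 →
      M.dataLaw p {y | (y, M.θstar) ∈ M.exceedanceSet V} ≤ η ∧
      ∫⁻ θ in M.par, ∫⁻ y, (M.exceedanceSet V).indicator 1 (y, θ) * M.ratio p y θ
        ∂M.dataLaw p ∂M.prior ≤ η := by
  have := M.isProbabilityMeasure_prior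
  obtain ⟨V, hstar, hprior⟩ := ((eventually_forall_setLIntegral_exceedanceSet_le (M := M) hη
    (Measure.dirac M.θstar)).and
    (eventually_forall_setLIntegral_exceedanceSet_le hη M.prior)).exists
  have hI : ∀ θ, Measurable fun y => (M.exceedanceSet V).indicator
      (1 : EuclideanSpace ℝ (Fin m) × EuclideanSpace ℝ (Fin d) → ℝ≥0∞) (y, θ) := fun θ =>
    (measurable_one.indicator measurableSet_exceedanceSet).comp measurable_prodMk_right
  refine ⟨V, fun p hp hp1 => ⟨?_, ?_⟩⟩
  · classical
    have h := hstar p hp.le hp1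
    rw [setLIntegral_dirac, if_pos M.θstar_mem,
      ← lintegral_dataLaw (hI M.θstar)] at h
    exact (lintegral_indicator_one (s := {y | (y, M.θstar) ∈ M.exceedanceSet V})
      (measurableSet_exceedanceSet.preimage measurable_prodMk_right)).symm.le.trans h
  · refine le_trans (lintegral_mono fun θ => le_of_eq ?_) (hprior p hp.le hp1)
    rw [← lintegral_ratio_mul hp hp1 θ (hI θ)]
    simp only [mul_comm]

lemma measure_pi_exists_mem_exceedanceSet_le {n : ℕ} (hp : 0 ≤ p) (hp1 : p ≤ 1)
    (θ : EuclideanSpace ℝ (Fin d)) :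
    (Measure.pi fun _ : Fin n => M.dataLaw p) {x | ∃ j, (x j, θ) ∈ M.exceedanceSet V}
      ≤ n * M.dataLaw p {y | (y, θ) ∈ M.exceedanceSet V} := by
  have := isProbabilityMeasure_dataLaw (M := M) hp hp1
  simpa only [Fintype.card_fin] using! measure_pi_exists_mem_le (ι := Fin n) (M.dataLaw p)
    (s := {y | (y, θ) ∈ M.exceedanceSet V})
    (measurableSet_exceedanceSet.preimage measurable_prodMk_right)

end Exceedance

section PosteriorMass

variable {m d n : ℕ} {M : ContaminationModel m d} {p φ α t c c₁ c₃ c₄ : ℝ}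
  {Om : Set (EuclideanSpace ℝ (Fin d))}

lemma measure_lintegral_par_lt_le (hp : 0 < p) (hp1 : p ≤ 1) (hα : 0 < α) (hc₃ : 0 < c₃)
    (ht : 0 ≤ t)
    (h : ENNReal.ofReal (c₃ * Real.exp (-(2 * n * t))) ≤ M.prior (M.rhoBall 0 α t)) :
    (Measure.pi fun _ : Fin n => M.dataLaw p)
        {x | ∫⁻ θ in M.par, likRatio (M.ratio p) x θ ∂M.prior
          < ENNReal.ofReal (c₃ / 2 * Real.exp (-(4 * n * t)))}
      ≤ 2 * ENNReal.ofReal (Real.exp (-(n * (α * t)))) := by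
  have := isProbabilityMeasure_dataLaw (M := M) hp.le hp1
  have := M.isProbabilityMeasure_prior
  let S : Set (EuclideanSpace ℝ (Fin d)) := M.par ∩
    {θ | ∫⁻ x, (M.ratio p x θ)⁻¹ ^ α ∂M.dataLaw p ≤ ENNReal.ofReal (Real.exp (α * t))}
  have hS : MeasurableSet S := M.measurableSet_par.inter <| measurableSet_le
    (Measurable.lintegral_prod_left' (f := fun z : EuclideanSpace ℝ (Fin m) ×
      EuclideanSpace ℝ (Fin d) => (M.ratio p z.1 z.2)⁻¹ ^ α) (measurable_ratio.inv.pow_const α))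
    measurable_const
  have hsub : M.rhoBall 0 α t ⊆ S := fun θ hθ =>
    ⟨hθ.1, lintegral_inv_ratio_rpow_le hp hp1 hα ht hθ⟩
  have hhalf : (2 : ℝ≥0∞)⁻¹ = ENNReal.ofReal 2⁻¹ := by
    rw [ENNReal.ofReal_inv_of_pos two_pos, ENNReal.ofReal_ofNat]
  have hsq : Real.exp (-(4 * n * t)) = Real.exp (-(2 * n * t)) * Real.exp (-(2 * n * t)) := by
    rw [← Real.exp_add]
    ring_nf
  have hlevel : ENNReal.ofReal (c₃ / 2 * Real.exp (-(4 * n * t)))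
      ≤ 2⁻¹ * M.prior S * ENNReal.ofReal (Real.exp (-(2 * n * t))) :=
    calc ENNReal.ofReal (c₃ / 2 * Real.exp (-(4 * n * t)))
        = 2⁻¹ * ENNReal.ofReal (c₃ * Real.exp (-(2 * n * t)))
          * ENNReal.ofReal (Real.exp (-(2 * n * t))) := by
          rw [hhalf, ← ENNReal.ofReal_mul (by norm_num), ← ENNReal.ofReal_mul (by positivity),
            hsq]
          ring_nf
      _ ≤ 2⁻¹ * M.prior S * ENNReal.ofReal (Real.exp (-(2 * n * t))) := by
          gcongr
          exact h.trans (measure_mono hsub)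
  refine (measure_mono fun x hx => ?_).trans (measure_setLIntegral_likRatio_lt_le
    (M.dataLaw p) M.prior measurable_ratio (ratio_ne_zero hp hp1) hS hα fun θ hθ => hθ.2)
  exact (lintegral_mono_set inter_subset_left).trans_lt (lt_of_lt_of_le hx hlevel)

lemma measure_le_setLIntegral_likRatio_lt_hell_diff_le (hp : 0 < p) (hp1 : p ≤ 1)
    (hc : c ≤ 1 / 100) (hc₁ : c₁ ≤ 1 / 32) (hφ : 0 < φ)
    (hent : ∫⁻ u in Ioc (φ ^ 2 / 2 ^ 10) φ,
        sqrtBracketingEntropy M.obs u ((fun θ x => M.f x θ) '' Om)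
      ≤ ENNReal.ofReal (c * Real.sqrt n * φ ^ 2))
    {W : Set (EuclideanSpace ℝ (Fin d))} (hW : MeasurableSet W) (hOm : M.par \ Om ⊆ W) :
    (Measure.pi fun _ : Fin n => M.dataLaw p)
        {x | ENNReal.ofReal (Real.exp (-(n * (c₁ * φ ^ 2))))
          ≤ ∫⁻ θ in (M.par ∩ {θ | φ < M.hell p θ M.θstar}) \ W, likRatio (M.ratio p) x θ ∂M.prior}
      ≤ ENNReal.ofReal (2 * Real.exp (-(n * (c₁ * φ ^ 2)))) := by
  refine (measure_le_setLIntegral_likRatio_le_of_lt_hell hp hp1 hc hφ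
    ((measurableSet_lt_hell hφ.le).diff hW) (fun θ hθ => ?_) (fun θ hθ => hθ.1.1)
    (fun θ hθ => hθ.1.2) hent (by simpa using Real.exp_pos _) ENNReal.ofReal_ne_top).trans ?_
  · by_contra hθOm
    exact hθ.2 (hOm ⟨hθ.1.1, hθOm⟩)
  · rw [← ENNReal.ofReal_div_of_pos (Real.exp_pos _), ← Real.exp_sub,
      ← ENNReal.ofReal_add (Real.exp_pos _).le (Real.exp_pos _).le, two_mul]
    have hnφ : n * (c₁ * φ ^ 2) ≤ n * (1 / 32 * φ ^ 2) := by gcongr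
    refine ENNReal.ofReal_le_ofReal (add_le_add ?_ ?_) <;> refine Real.exp_le_exp.2 ?_ <;>
      linarith

lemma measure_le_setLIntegral_likRatio_inter_le_of_prior_le (hp : 0 < p) (hp1 : p ≤ 1)
    {W : Set (EuclideanSpace ℝ (Fin d))} (hW : MeasurableSet W)
    (htail : M.prior W ≤ ENNReal.ofReal (c₄ * Real.exp (-(2 * c₁ * n * φ ^ 2)))) :
    (Measure.pi fun _ : Fin n => M.dataLaw p)
        {x | ENNReal.ofReal (Real.exp (-(n * (c₁ * φ ^ 2))))
          ≤ ∫⁻ θ in M.par ∩ W, likRatio (M.ratio p) x θ ∂M.prior}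
      ≤ ENNReal.ofReal (c₄ * Real.exp (-(n * (c₁ * φ ^ 2)))) := by
  have := isProbabilityMeasure_dataLaw (M := M) hp.le hp1
  have := M.isProbabilityMeasure_prior
  have hρ0 : ENNReal.ofReal (Real.exp (-(n * (c₁ * φ ^ 2)))) ≠ 0 := by simpa using Real.exp_pos _
  refine (measure_le_setLIntegral_likRatio_le (M.dataLaw p) M.prior measurable_ratio
    (M.measurableSet_par.inter hW) (fun θ hθ => (lintegral_ratio hp hp1 hθ.1).le)
    hρ0 ENNReal.ofReal_ne_top).trans ((ENNReal.div_le_iff hρ0 ENNReal.ofReal_ne_top).2 ?_)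
  rw [← ENNReal.ofReal_mul' (Real.exp_pos _).le, mul_assoc, ← Real.exp_add]
  exact (measure_mono inter_subset_right).trans (htail.trans_eq (by ring_nf))

lemma measure_le_setLIntegral_likRatio_lt_hell_le (hp : 0 < p) (hp1 : p ≤ 1) (hc : c ≤ 1 / 100)
    (hc₁ : c₁ ≤ 1 / 32) (hc₄ : 0 ≤ c₄) (hφ : 0 < φ)
    (hent : ∫⁻ u in Ioc (φ ^ 2 / 2 ^ 10) φ,
        sqrtBracketingEntropy M.obs u ((fun θ x => M.f x θ) '' Om)
      ≤ ENNReal.ofReal (c * Real.sqrt n * φ ^ 2))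
    (htail : M.prior (M.par \ Om) ≤ ENNReal.ofReal (c₄ * Real.exp (-(2 * c₁ * n * φ ^ 2)))) :
    (Measure.pi fun _ : Fin n => M.dataLaw p)
        {x | 2 * ENNReal.ofReal (Real.exp (-(n * (c₁ * φ ^ 2))))
          ≤ ∫⁻ θ in M.par ∩ {θ | φ < M.hell p θ M.θstar}, likRatio (M.ratio p) x θ ∂M.prior}
      ≤ ENNReal.ofReal ((2 + c₄) * Real.exp (-(n * (c₁ * φ ^ 2)))) := by
  let W := toMeasurable M.prior (M.par \ Om)
  have hW : MeasurableSet W := measurableSet_toMeasurable _ _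
  have hsieve := measure_le_setLIntegral_likRatio_lt_hell_diff_le (n := n) hp hp1 hc hc₁ hφ hent hW
    (subset_toMeasurable _ _)
  have htailmass := measure_le_setLIntegral_likRatio_inter_le_of_prior_le hp hp1 hW
    ((measure_toMeasurable _).trans_le htail)
  rw [add_mul, ENNReal.ofReal_add (by positivity) (by positivity)]
  refine (measure_mono fun x hx => ?_).trans
    ((measure_union_le _ _).trans (add_le_add hsieve htailmass))
  by_contra hsmall
  simp only [mem_union, mem_ofPred_eq, not_or, not_le] at hsmall
  refine (lt_of_le_of_lt ?_ (ENNReal.add_lt_add hsmall.1 hsmall.2)).not_ge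
    ((two_mul (ENNReal.ofReal _)).symm.le.trans hx)
  refine (lintegral_mono_set fun θ hθ => ?_).trans (lintegral_union_le _ _ _)
  exact (em (θ ∈ W)).elim (fun h => Or.inr ⟨hθ.1, h⟩) fun h => Or.inl ⟨hθ, h⟩

lemma measure_le_setLIntegral_likRatio_exceedanceSet_le {V : ℝ} {b κ η : ℝ≥0∞} (hp : 0 < p)
    (hp1 : p ≤ 1) (hκ0 : κ ≠ 0) (hκ : κ ≠ ∞) (hη : n * η ≤ b * κ)
    (hprior : ∫⁻ θ in M.par, ∫⁻ y, (M.exceedanceSet V).indicator 1 (y, θ) * M.ratio p y θ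
      ∂M.dataLaw p ∂M.prior ≤ η) :
    (Measure.pi fun _ : Fin n => M.dataLaw p)
        {x | κ ≤ ∫⁻ θ in M.par ∩ {θ | ∃ j, (x j, θ) ∈ M.exceedanceSet V},
          likRatio (M.ratio p) x θ ∂M.prior} ≤ b := by
  have := isProbabilityMeasure_dataLaw (M := M) hp.le hp1
  have := M.isProbabilityMeasure_prior
  refine (measure_le_setLIntegral_likRatio_le_of_exists (M.dataLaw p) M.prior measurable_ratio
    M.measurableSet_par (fun θ hθ => (lintegral_ratio hp hp1 hθ).le)
    measurableSet_exceedanceSet hκ0 hκ).trans (ENNReal.div_le_of_le_mul (le_trans ?_ hη))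
  gcongr

end PosteriorMass

section PrivacyFailure

variable {m d n : ℕ} {M : ContaminationModel m d} {p p₀ φ ψ τ T α c c₁ c₂ c₃ c₄ : ℝ}
  {Om : Set (EuclideanSpace ℝ (Fin d))}
  {P : Measure ((Fin n → EuclideanSpace ℝ (Fin m)) × (Fin n → EuclideanSpace ℝ (Fin m)))}

lemma measure_lintegral_par_lt_le_min_rate (hp : 0 < p) (hp1 : p ≤ 1) (hα : 0 < α)
    (hc₁ : 0 ≤ c₁) (hc₃ : 0 < c₃)
    (hcentre : ENNReal.ofReal (c₃ * Real.exp (-(2 * n * (c₁ * φ ^ 2 / 8))))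
      ≤ M.prior (M.rhoBall 0 α (c₁ * φ ^ 2 / 8))) :
    (Measure.pi fun _ : Fin n => M.dataLaw p)
        {x | ∫⁻ θ in M.par, likRatio (M.ratio p) x θ ∂M.prior
          < ENNReal.ofReal (c₃ / 2 * Real.exp (-(4 * n * (c₁ * φ ^ 2 / 8))))}
      ≤ ENNReal.ofReal (2 * Real.exp (-(n * min (c₁ * α / 8) c₂ * φ ^ 2))) := by
  refine (measure_lintegral_par_lt_le hp hp1 hα hc₃ (by positivity) hcentre).trans ?_
  rw [ENNReal.ofReal_mul two_pos.le, ENNReal.ofReal_ofNat,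
    show α * (c₁ * φ ^ 2 / 8) = c₁ * α / 8 * φ ^ 2 by ring]
  gcongr 2 * ENNReal.ofReal ?_
  exact exp_neg_mul_sq_le (min_le_left _ _)

lemma measure_privacyFailure_le_of_derivRatioBound (hp : 0 < p) (hp1 : p ≤ 1) (hc : c ≤ 1 / 100)
    (hc₁ : 0 ≤ c₁) (hc₁' : c₁ ≤ 1 / 32) (hc₂ : c₂ ≤ c₁) (hc₃ : 0 < c₃) (hc₄ : 0 ≤ c₄)
    (hφ : 0 < φ) (hα : 0 < α)
    (hent : ∫⁻ u in Ioc (φ ^ 2 / 2 ^ 10) φ,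
        sqrtBracketingEntropy M.obs u ((fun θ x => M.f x θ) '' Om)
      ≤ ENNReal.ofReal (c * Real.sqrt n * φ ^ 2))
    (hcentre : ENNReal.ofReal (c₃ * Real.exp (-(2 * n * (c₁ * φ ^ 2 / 8))))
      ≤ M.prior (M.rhoBall 0 α (c₁ * φ ^ 2 / 8)))
    (htail : M.prior (M.par \ Om) ≤ ENNReal.ofReal (c₄ * Real.exp (-(2 * c₁ * n * φ ^ 2))))
    (hM : M.HasBoundedDirDeriv) (hψ : M.RadiusBound p φ ψ) (hτ : M.DerivRatioBound ψ τ)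
    (hP : M.IsNeighbourLaw p n P) :
    P (M.privacyFailure p n (epsLevel (deltaLevel c₁ c₃ n φ) p τ ψ) (deltaLevel c₁ c₃ n φ))
      ≤ ENNReal.ofReal (2 * (4 + c₄) * Real.exp (-(n * min (c₁ * α / 8) c₂ * φ ^ 2))) := by
  have hstar : ‖M.θstar - M.θstar‖ ≤ ψ :=
    hψ M.θstar M.θstar_mem (by rw [hell_self]; exact hφ.le)
  have hratio : ∀ y ∈ M.obs, ∀ θ ∈ M.par, θ ∉ M.par ∩ {θ | φ < M.hell p θ M.θstar} →
      M.ratio p y θ ≤ ENNReal.ofReal (Real.exp (epsTilde p τ ψ / 2)) ∧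
      1 ≤ ENNReal.ofReal (Real.exp (epsTilde p τ ψ / 2)) * M.ratio p y θ := by
    intro y hy θ hθ hθU
    have hθψ : ‖θ - M.θstar‖ ≤ ψ := hψ θ hθ (not_lt.1 fun h => hθU ⟨hθ, h⟩)
    exact ⟨ratio_le_ofReal hp hp1 hy hθ (Real.exp_pos _).le
        (k_le_exp_mul hp hp1 hM hτ M.θstar_mem hθ hstar hθψ hθψ hy),
      one_le_ofReal_mul_ratio hp hp1 hy hθ (Real.exp_pos _).le
        (k_le_exp_mul hp hp1 hM hτ hθ M.θstar_mem hθψ hstar (by rwa [norm_sub_rev]) hy)⟩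
  have hfar : (Measure.pi fun _ : Fin n => M.dataLaw p)
      {x | 2 * ENNReal.ofReal (Real.exp (-(n * (c₁ * φ ^ 2)))) ≤ ∫⁻ θ in
        M.par ∩ (M.par ∩ {θ | φ < M.hell p θ M.θstar}), likRatio (M.ratio p) x θ ∂M.prior}
      ≤ ENNReal.ofReal ((2 + c₄) * Real.exp (-(n * min (c₁ * α / 8) c₂ * φ ^ 2))) := by
    rw [← inter_assoc, inter_self]
    refine (measure_le_setLIntegral_likRatio_lt_hell_le hp hp1 hc hc₁' hc₄ hφ hent htail).trans
      (ENNReal.ofReal_le_ofReal ?_)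
    gcongr (2 + c₄) * ?_
    exact exp_neg_mul_sq_le ((min_le_right _ _).trans hc₂)
  refine (measure_privacyFailure_le_of_ratio_le hP hp hp1 (deltaLevel_pos hc₃)
    (ENNReal.ofReal_pos.2 (by positivity)).ne' (ofReal_deltaLevel_mul hc₃).ge
    (fun _ => measurableSet_lt_hell hφ.le) (bad := ∅)
    (fun x z _ _ hx hz θ hθ hθU j => ⟨(hratio _ (hx j) θ hθ hθU).1, (hratio _ (hz j) θ hθ hθU).2⟩)
    measure_empty.le (measure_lintegral_par_lt_le_min_rate (c₂ := c₂) hp hp1 hα hc₁ hc₃ hcentre)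
    hfar).trans_eq ?_
  rw [zero_add, ← ENNReal.ofReal_add (by positivity) (by positivity), ← ENNReal.ofReal_ofNat 2,
    ← ENNReal.ofReal_mul two_pos.le]
  ring_nf

lemma measure_privacyFailure_le_of_exceedanceSet {V : ℝ} {η : ℝ≥0∞} (hp : 0 < p) (hp1 : p ≤ 1)
    (hc₁ : 0 ≤ c₁) (hc₂ : c₂ ≤ c₁) (hc₃ : 0 < c₃) (hα : 0 < α) (hV : 0 ≤ V)
    (hT : V + 1 ≤ (1 - p) * T * ψ)
    (hη : n * η ≤ ENNReal.ofReal (Real.exp (-(n * (c₁ * φ ^ 2)))) ^ 2)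
    (hstar : M.dataLaw p {y | (y, M.θstar) ∈ M.exceedanceSet V} ≤ η)
    (hprior : ∫⁻ θ in M.par, ∫⁻ y, (M.exceedanceSet V).indicator 1 (y, θ) * M.ratio p y θ
      ∂M.dataLaw p ∂M.prior ≤ η)
    (hcentre : ENNReal.ofReal (c₃ * Real.exp (-(2 * n * (c₁ * φ ^ 2 / 8))))
      ≤ M.prior (M.rhoBall 0 α (c₁ * φ ^ 2 / 8))) (hP : M.IsNeighbourLaw p n P) :
    P (M.privacyFailure p n (epsLevel (deltaLevel c₁ c₃ n φ) p T ψ) (deltaLevel c₁ c₃ n φ))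
      ≤ ENNReal.ofReal (2 * 4 * Real.exp (-(n * min (c₁ * α / 8) c₂ * φ ^ 2))) := by
  have hρe : ENNReal.ofReal (Real.exp (-(n * (c₁ * φ ^ 2))))
      ≤ ENNReal.ofReal (Real.exp (-(n * min (c₁ * α / 8) c₂ * φ ^ 2))) :=
    ENNReal.ofReal_le_ofReal (exp_neg_mul_sq_le ((min_le_right _ _).trans hc₂))
  have hρ0 : ENNReal.ofReal (Real.exp (-(n * (c₁ * φ ^ 2)))) ≠ 0 := by simp [Real.exp_pos]
  have hρ1 : ENNReal.ofReal (Real.exp (-(n * (c₁ * φ ^ 2)))) ≤ 1 :=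
    ENNReal.ofReal_le_one.2 (Real.exp_le_one_iff.2 (by rw [neg_nonpos]; positivity))
  generalize hρ : ENNReal.ofReal (Real.exp (-(n * (c₁ * φ ^ 2)))) = ρ at hη hρe hρ0 hρ1
  have hsample : (Measure.pi fun _ : Fin n => M.dataLaw p)
      {x | ∃ j, (x j, M.θstar) ∈ M.exceedanceSet V} ≤ ρ :=
    calc _ ≤ n * M.dataLaw p {y | (y, M.θstar) ∈ M.exceedanceSet V} :=
          measure_pi_exists_mem_exceedanceSet_le hp.le hp1 _
      _ ≤ n * η := by gcongr
      _ ≤ ρ := hη.trans (pow_le_of_le_one zero_le hρ1 two_ne_zero)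
  have hposterior := measure_le_setLIntegral_likRatio_exceedanceSet_le (b := ρ) (κ := 2 * ρ) hp hp1
    (by simpa using hρ0) (ENNReal.mul_ne_top (by simp) (hρ1.trans_lt ENNReal.one_lt_top).ne)
    (hη.trans (by rw [sq]; gcongr; exact le_mul_of_one_le_left' one_le_two)) hprior
  have hU : ∀ x : Fin n → EuclideanSpace ℝ (Fin m),
      MeasurableSet {θ | ∃ j, (x j, θ) ∈ M.exceedanceSet V} := fun x => by
    rw [ofPred_exists]
    exact MeasurableSet.iUnion fun j => measurableSet_exceedanceSet.preimage measurable_prodMk_left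
  refine (measure_privacyFailure_le_of_ratio_le hP hp hp1 (deltaLevel_pos hc₃)
    (ENNReal.ofReal_pos.2 (by positivity)).ne' (hρ ▸ (ofReal_deltaLevel_mul hc₃).ge) hU
    (fun x z _ hz hxo hzo θ hθ hθU j => ⟨?_, ?_⟩) (hsample.trans hρe)
    (measure_lintegral_par_lt_le_min_rate (c₂ := c₂) hp hp1 hα hc₁ hc₃ hcentre)
    (hposterior.trans hρe)).trans_eq ?_
  · exact ratio_le_ofReal hp hp1 (hxo j) hθ (Real.exp_pos _).le
      (k_le_exp_mul_of_notMem_exceedanceSet hp hp1 hV hT (hxo j) hθ M.θstar_mem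
        fun h => hθU ⟨j, h⟩)
  · exact one_le_ofReal_mul_ratio hp hp1 (hzo j) hθ (Real.exp_pos _).le
      (k_le_exp_mul_of_notMem_exceedanceSet hp hp1 hV hT (hzo j) M.θstar_mem hθ
        fun h => hz ⟨j, h⟩)
  · rw [← ENNReal.ofReal_add (by positivity) (by positivity),
      ← ENNReal.ofReal_add (by positivity) (by positivity), ← ENNReal.ofReal_ofNat 2,
      ← ENNReal.ofReal_mul two_pos.le]
    ring_nf

/-- Every radius admissible for some `p` is at least the distance to `θstar` of a second parameter
within Hellinger distance `φ`, so a large `T` makes `T * ψ` large uniformly in `p` and `ψ`. -/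
lemma exists_forall_measure_privacyFailure_le_of_nontrivial (hpar : M.par.Nontrivial)
    (hp₀ : p₀ < 1) (hc₁ : 0 ≤ c₁) (hc₂ : c₂ ≤ c₁) (hc₃ : 0 < c₃) (hφ : 0 < φ) (hα : 0 < α)
    (hcentre : ENNReal.ofReal (c₃ * Real.exp (-(2 * n * (c₁ * φ ^ 2 / 8))))
      ≤ M.prior (M.rhoBall 0 α (c₁ * φ ^ 2 / 8))) :
    ∃ T : ℝ, 0 < T ∧ ∀ p ψ : ℝ, 0 < p → p ≤ p₀ → M.RadiusBound p φ ψ →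
      ∀ P : Measure ((Fin n → EuclideanSpace ℝ (Fin m)) × (Fin n → EuclideanSpace ℝ (Fin m))),
      M.IsNeighbourLaw p n P →
      P (M.privacyFailure p n (epsLevel (deltaLevel c₁ c₃ n φ) p T ψ) (deltaLevel c₁ c₃ n φ))
        ≤ ENNReal.ofReal (2 * 4 * Real.exp (-(n * min (c₁ * α / 8) c₂ * φ ^ 2))) := by
  obtain ⟨V, hV⟩ := M.exists_exceedanceSet_threshold
    (η := ENNReal.ofReal (Real.exp (-(n * (c₁ * φ ^ 2)))) ^ 2 / n)
    (by simp [ENNReal.div_eq_zero_iff, Real.exp_pos])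
  obtain ⟨θ₂, hθ₂, hne, hhell⟩ := exists_ne_hell_le le_rfl zero_le_one hpar hφ
  have hs : 0 < ‖θ₂ - M.θstar‖ := norm_pos_iff.2 (sub_ne_zero.2 hne)
  have hp₀' : 0 < 1 - p₀ := sub_pos.2 hp₀
  refine ⟨(V + 1) / ((1 - p₀) * ‖θ₂ - M.θstar‖), by positivity, fun p ψ hp hpp₀ hψ P hP => ?_⟩
  have hp1 : p ≤ 1 := hpp₀.trans hp₀.le
  have hsψ : ‖θ₂ - M.θstar‖ ≤ ψ :=
    hψ θ₂ hθ₂ ((hell_le_hell_zero hp.le hp1 hθ₂ M.θstar_mem).trans hhell)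
  refine measure_privacyFailure_le_of_exceedanceSet hp hp1 hc₁ hc₂ hc₃ hα V.cast_nonneg ?_
    ENNReal.mul_div_le (hV p hp hp1).1 (hV p hp hp1).2 hcentre hP
  calc (V : ℝ) + 1
      = (1 - p₀) * ((V + 1) / ((1 - p₀) * ‖θ₂ - M.θstar‖)) * ‖θ₂ - M.θstar‖ := by field_simp
    _ ≤ (1 - p) * ((V + 1) / ((1 - p₀) * ‖θ₂ - M.θstar‖)) * ψ := by gcongr

lemma derivRatioBound_of_subsingleton (hpar : M.par.Subsingleton) (hτ : 0 ≤ τ) :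
    M.DerivRatioBound ψ τ := by
  intro θ hθ _ x _
  have hfeas : feasibleDirections M.par θ = ∅ := by
    refine eq_empty_of_forall_notMem ?_
    rintro u ⟨hu, ξ, hξ, hmem⟩
    have hu0 : u = 0 := by simpa [hξ.ne'] using hpar hmem hθ
    simp [hu0] at hu
  simpa [supDirDeriv, hfeas] using hτ

lemma exists_forall_measure_privacyFailure_le (hp₀ : p₀ < 1) (hc : c ≤ 1 / 100) (hc₁ : 0 ≤ c₁)
    (hc₁' : c₁ ≤ 1 / 32) (hc₂ : c₂ ≤ c₁) (hc₃ : 0 < c₃) (hc₄ : 0 ≤ c₄) (hφ : 0 < φ) (hα : 0 < α)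
    (hent : ∫⁻ u in Ioc (φ ^ 2 / 2 ^ 10) φ,
        sqrtBracketingEntropy M.obs u ((fun θ x => M.f x θ) '' Om)
      ≤ ENNReal.ofReal (c * Real.sqrt n * φ ^ 2))
    (hcentre : ENNReal.ofReal (c₃ * Real.exp (-(2 * n * (c₁ * φ ^ 2 / 8))))
      ≤ M.prior (M.rhoBall 0 α (c₁ * φ ^ 2 / 8)))
    (htail : M.prior (M.par \ Om) ≤ ENNReal.ofReal (c₄ * Real.exp (-(2 * c₁ * n * φ ^ 2))))
    (hM : M.HasBoundedDirDeriv) :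
    ∃ T : ℝ, 0 < T ∧ ∀ p ψ τ : ℝ, 0 < p → p ≤ p₀ → M.RadiusBound p φ ψ →
      (τ = T ∨ M.DerivRatioBound ψ τ) →
      ∀ P : Measure ((Fin n → EuclideanSpace ℝ (Fin m)) × (Fin n → EuclideanSpace ℝ (Fin m))),
      M.IsNeighbourLaw p n P →
      P (M.privacyFailure p n (epsLevel (deltaLevel c₁ c₃ n φ) p τ ψ) (deltaLevel c₁ c₃ n φ))
        ≤ ENNReal.ofReal (2 * (4 + c₄) * Real.exp (-(n * min (c₁ * α / 8) c₂ * φ ^ 2))) := by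
  obtain ⟨T, hT, hTbound⟩ : ∃ T : ℝ, 0 < T ∧ ∀ p ψ : ℝ, 0 < p → p ≤ p₀ → M.RadiusBound p φ ψ →
      M.DerivRatioBound ψ T ∨
      ∀ P : Measure ((Fin n → EuclideanSpace ℝ (Fin m)) × (Fin n → EuclideanSpace ℝ (Fin m))),
      M.IsNeighbourLaw p n P →
      P (M.privacyFailure p n (epsLevel (deltaLevel c₁ c₃ n φ) p T ψ) (deltaLevel c₁ c₃ n φ))
        ≤ ENNReal.ofReal (2 * 4 * Real.exp (-(n * min (c₁ * α / 8) c₂ * φ ^ 2))) := by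
    rcases M.par.subsingleton_or_nontrivial with hpar | hpar
    · exact ⟨1, one_pos, fun _ _ _ _ _ =>
        Or.inl (derivRatioBound_of_subsingleton hpar zero_le_one)⟩
    · obtain ⟨T, hT, hTbound⟩ := exists_forall_measure_privacyFailure_le_of_nontrivial hpar hp₀ hc₁
        hc₂ hc₃ hφ hα hcentre
      exact ⟨T, hT, fun p ψ hp hpp₀ hψ => Or.inr (hTbound p ψ hp hpp₀ hψ)⟩
  refine ⟨T, hT, fun p ψ τ hp hpp₀ hψ hτ P hP => ?_⟩
  have hderiv : ∀ τ', M.DerivRatioBound ψ τ' → _ := fun τ' hτ' =>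
    measure_privacyFailure_le_of_derivRatioBound hp (hpp₀.trans hp₀.le) hc hc₁ hc₁' hc₂ hc₃ hc₄ hφ
      hα hent hcentre htail hM hψ hτ' hP
  rcases hτ with rfl | hτ
  · refine (hTbound p ψ hp hpp₀ hψ).elim (hderiv τ) fun h => (h P hP).trans ?_
    gcongr
    exact le_add_of_nonneg_right hc₄
  · exact hderiv τ hτ

end PrivacyFailure

end ContaminationModel

theorem mainTheorem1_general {m d : ℕ} (M : ContaminationModel m d) (φ : ℕ → ℝ)
    (Om : ℕ → Set (EuclideanSpace ℝ (Fin d))) {c c₁ c₂ c₃ c₄ α p₀ : ℝ} (hc : c ≤ 1 / 100)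
    (hc₁ : 0 < c₁) (hc₁' : c₁ ≤ 1 / 32) (hc₂ : 0 < c₂) (hc₂₁ : c₂ ≤ c₁) (hc₃ : 0 < c₃)
    (hc₄ : 0 ≤ c₄) (hα : 0 < α) (hp₀ : p₀ < 1) (hφ : ∀ n, 1 ≤ n → 0 < φ n)
    (hφ0 : Tendsto φ atTop (𝓝 0)) (hnφ : Tendsto (fun n : ℕ => (n : ℝ) * φ n ^ 2) atTop atTop)
    (hent : ∀ n, 1 ≤ n → ∫⁻ u in Ioc (φ n ^ 2 / 2 ^ 10) (φ n),
        sqrtBracketingEntropy M.obs u ((fun θ x => M.f x θ) '' Om n)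
      ≤ ENNReal.ofReal (c * Real.sqrt n * φ n ^ 2))
    (hcentre : ∀ n : ℕ, 1 ≤ n → ENNReal.ofReal (c₃ * Real.exp (-(2 * n * (c₁ * φ n ^ 2 / 8))))
      ≤ M.prior (M.rhoBall 0 α (c₁ * φ n ^ 2 / 8)))
    (htail : M.PriorTailAssumption c₁ c₄ φ Om) (hM : M.HasBoundedDirDeriv)
    (hid : M.IdentifiabilityAssumption) :
    ∃ (T : ℕ → ℝ) (C₁ C₂ C₃ : ℝ), (∀ n, 0 < T n) ∧ 0 < C₁ ∧ 0 < C₂ ∧ 0 < C₃ ∧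
    ∀ p : ℕ → ℝ, (∀ n, 1 ≤ n → 0 < p n ∧ p n ≤ p₀) →
      (∃ ψ : ℕ → ℝ, Tendsto ψ atTop (𝓝 0) ∧ ∀ᶠ n in atTop, M.RadiusBound (p n) (φ n) (ψ n)) ∧
      ∀ (ψ τ : ℕ → ℝ)
        (P : ∀ n : ℕ, Measure
          ((Fin n → EuclideanSpace ℝ (Fin m)) × (Fin n → EuclideanSpace ℝ (Fin m)))),
        (∀ n, 1 ≤ n → M.IsNeighbourLaw (p n) n (P n)) →
        (∀ n, 1 ≤ n → M.RadiusBound (p n) (φ n) (ψ n) →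
          (τ n = T n ∨ M.DerivRatioBound (ψ n) (τ n)) →
          P n (M.privacyFailure (p n) n
              (epsLevel (deltaLevel c₁ c₃ n (φ n)) (p n) (τ n) (ψ n))
              (deltaLevel c₁ c₃ n (φ n)))
            ≤ ENNReal.ofReal (failureBound c₁ c₂ α C₁ C₂ C₃ n (φ n))) ∧
        ((∀ᶠ n in atTop, M.RadiusBound (p n) (φ n) (ψ n) ∧
            (τ n = T n ∨ M.DerivRatioBound (ψ n) (τ n))) →
          Tendsto (fun n => P n (M.privacyFailure (p n) n
              (epsLevel (deltaLevel c₁ c₃ n (φ n)) (p n) (τ n) (ψ n))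
              (deltaLevel c₁ c₃ n (φ n)))) atTop (𝓝 0)) := by
  choose! T hT hbound using fun n (hn : 1 ≤ n) =>
    ContaminationModel.exists_forall_measure_privacyFailure_le hp₀ hc hc₁.le hc₁' hc₂₁ hc₃ hc₄
      (hφ n hn) hα (hent n hn) (hcentre n hn) (htail n hn) hM
  have hC : 0 < 2 * (4 + c₄) := by positivity
  -- `max n 1` only supplies a positive value at `n = 0`
  refine ⟨fun n => T (max n 1), 2 * (4 + c₄), 2 * (4 + c₄), 1, fun n => hT _ (le_max_right n 1),
    hC, hC, one_pos, fun p hp => ⟨?_, fun ψ τ P hP => ?_⟩⟩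
  · exact ContaminationModel.exists_tendsto_radiusBound hid (eventually_atTop.2 ⟨1, hφ⟩) hφ0 hp₀
      (eventually_atTop.2 ⟨1, fun n hn => ⟨(hp n hn).1.le, (hp n hn).2⟩⟩)
  have hfailure : ∀ n, 1 ≤ n → M.RadiusBound (p n) (φ n) (ψ n) →
      (τ n = T (max n 1) ∨ M.DerivRatioBound (ψ n) (τ n)) → _ := fun n hn hψ hτ =>
    (hbound n hn (p n) (ψ n) (τ n) (hp n hn).1 (hp n hn).2 hψ
      (by rwa [max_eq_left hn] at hτ) (P n) (hP n hn)).trans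
        (ENNReal.ofReal_le_ofReal le_failureBound)
  refine ⟨hfailure, fun hev => tendsto_of_tendsto_of_tendsto_of_le_of_le' tendsto_const_nhds
    (by simpa using ENNReal.tendsto_ofReal (tendsto_failureBound (C₁ := 2 * (4 + c₄))
      (C₂ := 2 * (4 + c₄)) (C₃ := 1) hc₁ hc₂ hα hnφ))
    (Eventually.of_forall fun _ => zero_le) ?_⟩
  filter_upwards [hev, eventually_ge_atTop 1] with n hn hn1 using hfailure n hn1 hn.1 hn.2

theorem mainTheorem1 :
    -- universal constants of the entropy bound, which enter the assumptions
    ∃ c c₁ c₂ : ℝ, 0 < c ∧ 0 < c₁ ∧ 0 < c₂ ∧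
    ∀ (m d : ℕ) (M : ContaminationModel m d) (φ : ℕ → ℝ)
      (Om : ℕ → Set (EuclideanSpace ℝ (Fin d))) (α c₃ c₄ : ℝ),
      0 < α → α ≤ 1 → 0 < c₃ → 0 < c₄ →
      AntitoneOn φ (Set.Ici 1) →
      M.EntropyAssumption c φ Om →
      M.PriorCentreAssumption c₁ c₂ α c₃ φ →
      M.PriorTailAssumption c₁ c₄ φ Om →
      M.TailAssumption →
      M.IdentifiabilityAssumption →
    ∀ p₀ : ℝ, 0 < p₀ → p₀ < 1 →
    ∃ (T : ℕ → ℝ) (C₁ C₂ C₃ : ℝ), (∀ n, 0 < T n) ∧ 0 < C₁ ∧ 0 < C₂ ∧ 0 < C₃ ∧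
    ∀ p : ℕ → ℝ, (∀ n, 1 ≤ n → 0 < p n ∧ p n ≤ p₀) → AntitoneOn p (Set.Ici 1) →
      Tendsto p atTop (𝓝 0) →
      -- the radii `ψ n` exist and tend to zero
      (∃ ψ : ℕ → ℝ, Tendsto ψ atTop (𝓝 0) ∧ ∀ᶠ n in atTop, M.RadiusBound (p n) (φ n) (ψ n)) ∧
      -- the bounds hold with any admissible radii, with `T n`, and with any bound on `|∇̃f / g|`
      -- over the Euclidean ball of radius `ψ n` in place of `T n`
      ∀ (ψ τ : ℕ → ℝ)
        (P : ∀ n : ℕ, Measure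
          ((Fin n → EuclideanSpace ℝ (Fin m)) × (Fin n → EuclideanSpace ℝ (Fin m)))),
        (∀ n, 1 ≤ n → M.IsNeighbourLaw (p n) n (P n)) →
        (∀ n, 1 ≤ n → M.RadiusBound (p n) (φ n) (ψ n) →
          (τ n = T n ∨ M.DerivRatioBound (ψ n) (τ n)) →
          P n (M.privacyFailure (p n) n
              (epsLevel (deltaLevel c₁ c₃ n (φ n)) (p n) (τ n) (ψ n))
              (deltaLevel c₁ c₃ n (φ n)))
            ≤ ENNReal.ofReal (failureBound c₁ c₂ α C₁ C₂ C₃ n (φ n))) ∧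
        ((∀ᶠ n in atTop, M.RadiusBound (p n) (φ n) (ψ n) ∧
            (τ n = T n ∨ M.DerivRatioBound (ψ n) (τ n))) →
          Tendsto (fun n => P n (M.privacyFailure (p n) n
              (epsLevel (deltaLevel c₁ c₃ n (φ n)) (p n) (τ n) (ψ n))
              (deltaLevel c₁ c₃ n (φ n)))) atTop (𝓝 0)) := by
  refine ⟨1 / 100, 1 / 32, 1 / 32, by norm_num, by norm_num, by norm_num, ?_⟩
  intro m d M φ Om α c₃ c₄ hα _ hc₃ hc₄ _ ⟨hφ, hφ0, hnφ, _, _, hent⟩ hcentre htail hT hid p₀ _ hp₀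
  obtain ⟨T, C₁, C₂, C₃, hT0, hC₁, hC₂, hC₃, hp⟩ := mainTheorem1_general M φ Om le_rfl
    (by norm_num) le_rfl (by norm_num) le_rfl hc₃ hc₄.le hα hp₀ hφ hφ0 hnφ hent
    (fun n hn => (hcentre n hn).1) htail hT.1 hid
  exact ⟨T, C₁, C₂, C₃, hT0, hC₁, hC₂, hC₃, fun p hpp₀ _ _ => hp p hpp₀⟩
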